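/- For finite sets $A,C\subset\mathbb C$ define $I_{A,C}(n)$ by $\sum_{n\ge1} I_{A,C}(n)n^{-s}=\prod_{\alpha\in A}\zeta(s+\alpha)\big/\prod_{\gamma\in C}\zeta(s+\gamma)$, and let $\mathcal B_{A,B,C,D}(u)$ denote the meromorphic continuation of $\sum_{n\ge1} I_{A,C}(n)I_{B,D}(n)n^{-u}$. Write $e(x)=e^{2\pi i x}$, let $r_q(h)=\sum_{a \bmod q,\,(a,q)=1}e(ah/q)$ be Ramanujan's sum, and let $\chi(s)=2^s\pi^{s-1}\sin(\pi s/2)\Gamma(1-s)$ be the factor in the functional equation $\zeta(s)=\chi(s)\zeta(1-s)$. **Theorem.** Assume the Generalized Riemann Hypothesis for Dirichlet $L$-functions. Let $A,B,C,D$ be finite sets of complex numbers with $|\Re\alpha|,|\Re\beta|<1/4$ for $\alpha\in A$, $\beta\in B$, and $0<\Re\gamma,\Re\delta<1/4$ for $\gamma\in C$, $\delta\in D$. Let $0<\epsilon<1/2$ be larger than the absolute values of all elements of $A\cup B\cup C\cup D$, and let $\Re s>2\epsilon$. Put $$\mathcal C_{A,B,C,D}(s)=\sum_{q=1}^\infty\frac1{(2\pi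 i)^2}\int_{|w-1|=\epsilon}\int_{|z-1|=\epsilon}\chi(w+z-s-1)\sum_{h=1}^\infty\frac{r_q(h)}{h^{s+2-w-z}}\sum_{m=1}^\infty\frac{I_{A,C}(m)e(m/q)}{m^w}\sum_{n=1}^\infty\frac{I_{B,D}(n)e(n/q)}{n^z}\,dz\,dw ,$$ where the Dirichlet series in $h,m,n$ stand for their meromorphic continuations. These continuations exist and, on the contours, are analytic (apart from a possible pole of the $h$-series at the points where $s+2-w-z=1$), the series over $q$ converges absolutely, each $\mathcal B$ below is analytic at $s+1$, and $$\mathcal C_{A,B,C,D}(s)=\sum_{\substack{U\subset A,\ V\subset B\\ |U|=|V|=1}}\mathcal B_{A-U+(V+s)^-,\;B-V+(U+s)^-,\;C,\;D}(s+1).$$ Here $A-U+(V+s)^-=(A\setminus U)\cup\{-(v+s):v\in V\}$, and similarly for $B-V+(U+s)^-$. Equivalently, the right side is the sum of the one-swap terms $\mathcal B_{A_s-U+V^-,\,B-V+U^-,\,C_s,\,D}(1)$ over $U\subset A_s$, $V\subset B$, $|U|=|V|=1$, of the ratios conjecture for the shifted sets $A_s=\{\alpha+s\}$, $B$, $C_s=\{\gamma+s\}$,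 $D$ (where $V^-=\{-v:v\in V\}$). -/

import Mathlib

namespace OneSwap

noncomputable section

open Complex

/-- The Generalized Riemann Hypothesis for Dirichlet `L`-functions (modulus `1` gives `ζ`). -/
def GRH : Prop :=
  ∀ (N : ℕ) [NeZero N] (ψ : DirichletCharacter ℂ N) (s : ℂ),
    0 < s.re → s.re < 1 → DirichletCharacter.LFunction ψ s = 0 → s.re = 1 / 2

/-- The arithmetic function `n ↦ n^{-α}`, with Dirichlet series `ζ(s + α)`. -/
def powFun (α : ℂ) : ArithmeticFunction ℂ :=
  ⟨fun n => if n = 0 then 0 else (n : ℂ) ^ (-α), by simp⟩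

/-- The arithmetic function `n ↦ μ(n) n^{-γ}`, with Dirichlet series `1 / ζ(s + γ)`. -/
def muPowFun (γ : ℂ) : ArithmeticFunction ℂ :=
  ⟨fun n => if n = 0 then 0 else (ArithmeticFunction.moebius n : ℂ) * (n : ℂ) ^ (-γ), by simp⟩

/-- `I_{A,C}`: the coefficients of `∏_{α ∈ A} ζ(s + α) / ∏_{γ ∈ C} ζ(s + γ)`, as a Dirichlet
convolution. -/
def I (A C : Finset ℂ) : ArithmeticFunction ℂ :=
  (∏ α ∈ A, powFun α) * ∏ γ ∈ C, muPowFun γ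

/-- The additive character `e(x) = exp(2πix)`. -/
def e (x : ℂ) : ℂ := exp (2 * Real.pi * Complex.I * x)

/-- Ramanujan's sum `r_q(h)`. -/
def ramanujanSum (q h : ℕ) : ℂ :=
  ∑ a ∈ (Finset.range q).filter (fun a => Nat.Coprime a q), e ((a : ℂ) * h / q)

/-- The factor in the functional equation `ζ(s) = χ(s) ζ(1 - s)`. -/
def chi (s : ℂ) : ℂ :=
  2 ^ s * (Real.pi : ℂ) ^ (s - 1) * sin (Real.pi * s / 2) * Gamma (1 - s)

/-- The Dirichlet series `∑ a(n) n^{-w}`, absolutely convergent in some right half-plane, has a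
meromorphic continuation to a half-plane containing `u`; that continuation is analytic at `u`
and takes the value `v` there. -/
def HasContinuedValue (a : ℕ → ℂ) (u v : ℂ) : Prop :=
  ∃ (F : ℂ → ℂ) (σ τ : ℝ), σ < u.re ∧ MeromorphicOn F {w : ℂ | σ < w.re} ∧
    (∀ w : ℂ, τ < w.re → LSeriesSummable a w ∧ F w = LSeries a w) ∧
    AnalyticAt ℂ F u ∧ F u = v

/-- The meromorphic continuation of `∑ a(n) n^{-w}` exists and is analytic at `u`. -/
def ContinuesTo (a : ℕ → ℂ) (u : ℂ) : Prop := ∃ v, HasContinuedValue a u v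

open Classical in
/-- The value at `u` of the continuation of `∑ a(n) n^{-w}`. -/
def continuedLSeries (a : ℕ → ℂ) (u : ℂ) : ℂ :=
  if h : ContinuesTo a u then h.choose else 0

/-- The coefficients `I_{A,C}(m) e(m/q)`. -/
def twist (A C : Finset ℂ) (q : ℕ) (m : ℕ) : ℂ := I A C m * e ((m : ℂ) / q)

/-- The coefficients `I_{A,C}(n) I_{B,D}(n)` of the Rankin-Selberg convolution. -/
def rankinCoeff (A B C D : Finset ℂ) (n : ℕ) : ℂ := I A C n * I B D n

/-- The analytic continuation of the Rankin-Selberg convolution. -/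
def rankin (A B C D : Finset ℂ) (u : ℂ) : ℂ := continuedLSeries (rankinCoeff A B C D) u

/-- The `q`-th term of the double contour integral. -/
def correlationTerm (A B C D : Finset ℂ) (ε : ℝ) (s : ℂ) (q : ℕ) : ℂ :=
  1 / (2 * Real.pi * Complex.I) ^ 2 *
    ∮ w in C(1, ε), ∮ z in C(1, ε),
      chi (w + z - s - 1) * continuedLSeries (ramanujanSum q) (s + 2 - w - z) *
        continuedLSeries (twist A C q) w * continuedLSeries (twist B D q) z

/-- The correlation expression; the sum over `q` is taken term by term. -/
def correlation (A B C D : Finset ℂ) (ε : ℝ) (s : ℂ) : ℂ :=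
  ∑' q : ℕ+, correlationTerm A B C D ε s q

/-- `(V + s)^-`: every element `v` is replaced by `-(v + s)`. -/
def negShift (s : ℂ) (V : Finset ℂ) : Finset ℂ := V.image fun v => -(v + s)

/-- The continued value does not depend on the continuation. -/
theorem HasContinuedValue.unique {a : ℕ → ℂ} {u v₁ v₂ : ℂ}
    (h₁ : HasContinuedValue a u v₁) (h₂ : HasContinuedValue a u v₂) : v₁ = v₂ := by
  obtain ⟨F, σ, τ, hσ, hF, hFs, hFu, rfl⟩ := h₁
  obtain ⟨G, σ', τ', hσ', hG, hGs, hGu, rfl⟩ := h₂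
  set U : Set ℂ := {w : ℂ | max σ σ' < w.re} with hU
  have hm : MeromorphicOn (F - G) U := by
    intro w hw
    have hw' : max σ σ' < w.re := hw
    exact (hF w (lt_of_le_of_lt (le_max_left _ _) hw')).sub
      (hG w (lt_of_le_of_lt (le_max_right _ _) hw'))
  have hpre : IsPreconnected U := (convex_halfSpace_re_gt _).isPreconnected
  set x : ℂ := ((max (max τ τ') (max σ σ') + 1 : ℝ) : ℂ) with hx
  have hxre : x.re = max (max τ τ') (max σ σ') + 1 := by rw [hx]; exact ofReal_re _
  have hxU : x ∈ U := by
    change max σ σ' < x.re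
    rw [hxre]; linarith [le_max_right (max τ τ') (max σ σ')]
  have huU : u ∈ U := max_lt hσ hσ'
  have htop : meromorphicOrderAt (F - G) x = ⊤ := by
    rw [meromorphicOrderAt_eq_top_iff]
    have ho : IsOpen {w : ℂ | max τ τ' < w.re} := isOpen_lt continuous_const continuous_re
    have hmem : x ∈ {w : ℂ | max τ τ' < w.re} := by
      change max τ τ' < x.re
      rw [hxre]; linarith [le_max_left (max τ τ') (max σ σ')]
    filter_upwards [mem_nhdsWithin_of_mem_nhds (ho.mem_nhds hmem)] with w hw
    have hw' : max τ τ' < w.re := hw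
    simp [(hFs w (lt_of_le_of_lt (le_max_left _ _) hw')).2,
      (hGs w (lt_of_le_of_lt (le_max_right _ _) hw')).2]
  have hutop : meromorphicOrderAt (F - G) u = ⊤ := by
    by_contra hne
    exact hm.meromorphicOrderAt_ne_top_of_isPreconnected hpre huU hxU hne htop
  rw [meromorphicOrderAt_eq_top_iff] at hutop
  have hfr : ∃ᶠ w in nhdsWithin u {u}ᶜ, F w = G w :=
    (hutop.mono fun w hw => sub_eq_zero.mp hw).frequently
  exact ((hFu.frequently_eq_iff_eventually_eq hGu).mp hfr).self_of_nhds

theorem HasContinuedValue.continuedLSeries_eq {a : ℕ → ℂ} {u v : ℂ}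
    (h : HasContinuedValue a u v) : continuedLSeries a u = v := by
  have h' : ContinuesTo a u := ⟨v, h⟩
  rw [continuedLSeries, dif_pos h']
  exact h'.choose_spec.unique h

end

end OneSwap

/-! Fix `q`. Under GRH each twisted series continues to `Re w > 1/2`, with at most simple poles,
located at the points `1 - α`. Splitting the factor `n^{-α}` off the convolution and sorting by the
residue class of its variable, each class contributes residue `1/q`. The average of the additive
character over all classes detects `q ∣ n`, so the residue at `1 - α` is the continued series of `I
(A.erase α) C` over multiples of `q` (`GRH.tendsto_twist_residue`). The Ramanujan series is `ζ(u)
J_q(1 - u)` with `J_q(x) = ∑_{d ∣ q} μ(q/d) d^x` (`jordanSum`). The functional equation absorbs `χ`,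
and the kernel becomes `ζ(y) J_q(y)` with `y = w + z - s - 1`, which is analytic on the closed discs
because `Re y < 1` there. The double integral is therefore a finite sum over pairs `(α, β)` of a
kernel value times two residues (`GRH.correlationTerm_eq`).

It remains to sum over `q`. Far to the right, expand the Rankin-Selberg series of `n^b * f` and `n^a
* g`. For fixed variables `i`, `j` of `f`, `g`, the common multiples `n` contribute `ζ(y)
lcm(i,j)^{-y}` with `y = u - a - b`. Trading the lcm for the gcd and writing `gcd^y = ∑_{q ∣ gcd}
J_q(y)` by Möbius inversion decouples `i` from `j`, and gives `ζ(y) ∑_q J_q(y) F_q(u - a) G_q(u -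
b)`, where `F_q`, `G_q` are the series over multiples of `q` (`LSeries_rankin_eq`). At `a = α + s`,
`b = β + s`, `u = s + 1` this has exactly the shape of the residue sum for the pair `(α, β)`.

In general `s + 1` is not in the region of absolute convergence, so the identity is continued
(`hasContinuedValue_rankin`). One has `F_q = Z ρ_q`, where `Z` is a zeta quotient independent of `q`
that carries all the poles, and `ρ_q` is analytic with `|ρ_q(w)| ≤ τ(q)^M q^{-Re w - m}`, `m` being
a lower bound for the real parts of the shifts (`GRH.hasDvdFactor_I`). The bounds `1/4` on the
shifts and `Re s > 2ε` are what make the sum over `q` converge normally on a half-plane containing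
`s + 1`. -/

namespace OneSwap

open Complex Filter Topology

/-! ### Continuations to `Re w > 1/2` and their algebra. -/

/-- `F` continues the Dirichlet series with coefficients `a` meromorphically to the half-plane
`1 / 2 < re w`, analytically off `P`. -/
structure IsContinuation (a : ℕ → ℂ) (F : ℂ → ℂ) (P : Set ℂ) : Prop where
  meromorphicAt : ∀ w : ℂ, 1 / 2 < w.re → MeromorphicAt F w
  analyticAt : ∀ w : ℂ, 1 / 2 < w.re → w ∉ P → AnalyticAt ℂ F w
  exists_eq : ∃ τ : ℝ, ∀ w : ℂ, τ < w.re → LSeriesSummable a w ∧ F w = LSeries a w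

namespace IsContinuation

variable {a b : ℕ → ℂ} {F G : ℂ → ℂ} {P Q : Set ℂ}

theorem hasContinuedValue (h : IsContinuation a F P) {u : ℂ} (hu : 1 / 2 < u.re) (huP : u ∉ P) :
    HasContinuedValue a u (F u) := by
  obtain ⟨τ, hτ⟩ := h.exists_eq
  exact ⟨F, 1 / 2, τ, hu, fun w hw => h.meromorphicAt w hw, hτ, h.analyticAt u hu huP, rfl⟩

theorem continuesTo (h : IsContinuation a F P) {u : ℂ} (hu : 1 / 2 < u.re) (huP : u ∉ P) :
    ContinuesTo a u := ⟨_, h.hasContinuedValue hu huP⟩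

theorem continuedLSeries_eq (h : IsContinuation a F P) {u : ℂ} (hu : 1 / 2 < u.re)
    (huP : u ∉ P) : continuedLSeries a u = F u :=
  (h.hasContinuedValue hu huP).continuedLSeries_eq

theorem mono (h : IsContinuation a F P) (hPQ : P ⊆ Q) : IsContinuation a F Q :=
  ⟨h.meromorphicAt, fun w hw hQ => h.analyticAt w hw fun hP => hQ (hPQ hP), h.exists_eq⟩

theorem congr (h : IsContinuation a F P) (hab : ∀ n, n ≠ 0 → a n = b n) :
    IsContinuation b F P := by
  obtain ⟨τ, hτ⟩ := h.exists_eq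
  refine ⟨h.meromorphicAt, h.analyticAt, τ, fun w hw => ?_⟩
  rw [← LSeriesSummable_congr w (fun {n} hn => hab n hn),
    ← LSeries_congr (fun {n} hn => hab n hn) w]
  exact hτ w hw

theorem sum {ι : Type*} {S : Finset ι} {a : ι → ℕ → ℂ} {F : ι → ℂ → ℂ}
    (h : ∀ i ∈ S, IsContinuation (a i) (F i) P) :
    IsContinuation (fun n => ∑ i ∈ S, a i n) (fun w => ∑ i ∈ S, F i w) P := by
  refine ⟨fun w hw => MeromorphicAt.fun_sum fun i hi => (h i hi).meromorphicAt w hw,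
    fun w hw hP => Finset.analyticAt_fun_sum _ fun i hi => (h i hi).analyticAt w hw hP, ?_⟩
  choose! τ hτ using fun i hi => (h i hi).exists_eq
  obtain ⟨M, hM⟩ := (S.image τ).bddAbove
  refine ⟨M, fun w hw => ?_⟩
  have hi : ∀ i ∈ S, LSeriesSummable (a i) w ∧ F i w = LSeries (a i) w := fun i hi =>
    hτ i hi w (lt_of_le_of_lt (hM (by simpa using ⟨i, hi, rfl⟩)) hw)
  have hf : (fun n => ∑ i ∈ S, a i n) = ∑ i ∈ S, a i := by ext n; simp
  rw [hf]
  refine ⟨LSeriesSummable.sum fun i hi' => (hi i hi').1, ?_⟩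
  rw [LSeries_sum fun i hi' => (hi i hi').1]
  exact Finset.sum_congr rfl fun i hi' => (hi i hi').2

theorem const_mul (c : ℂ) (h : IsContinuation a F P) :
    IsContinuation (fun n => c * a n) (fun w => c * F w) P := by
  obtain ⟨τ, hτ⟩ := h.exists_eq
  refine ⟨fun w hw => (MeromorphicAt.const c w).fun_mul (h.meromorphicAt w hw),
    fun w hw hP => analyticAt_const.fun_mul (h.analyticAt w hw hP), τ, fun w hw => ?_⟩
  have hf : (fun n => c * a n) = c • a := by ext n; simp
  rw [hf]
  exact ⟨(hτ w hw).1.smul c, by rw [LSeries_smul, (hτ w hw).2]⟩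

theorem convolution (hf : IsContinuation a F P) (hg : IsContinuation b G P) :
    IsContinuation (LSeries.convolution a b) (fun w => F w * G w) P := by
  obtain ⟨τ, hτ⟩ := hf.exists_eq
  obtain ⟨τ', hτ'⟩ := hg.exists_eq
  refine ⟨fun w hw => (hf.meromorphicAt w hw).fun_mul (hg.meromorphicAt w hw),
    fun w hw hP => (hf.analyticAt w hw hP).fun_mul (hg.analyticAt w hw hP), max τ τ',
    fun w hw => ?_⟩
  obtain ⟨h1, h2⟩ := hτ w (lt_of_le_of_lt (le_max_left _ _) hw)
  obtain ⟨h3, h4⟩ := hτ' w (lt_of_le_of_lt (le_max_right _ _) hw)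
  exact ⟨h1.convolution h3, by rw [LSeries_convolution' h1 h3, h2, h4]⟩

theorem congr_fun (h : IsContinuation a F P) (hFG : ∀ w, F w = G w) : IsContinuation a G P := by
  rwa [← funext hFG]

/-- A continuation may be replaced by a function that agrees with it far to the right. -/
theorem of_eq (h : IsContinuation a F P) (hG : ∀ w : ℂ, 1 / 2 < w.re → MeromorphicAt G w)
    (hG' : ∀ w : ℂ, 1 / 2 < w.re → w ∉ Q → AnalyticAt ℂ G w)
    (hFG : ∃ τ : ℝ, ∀ w : ℂ, τ < w.re → G w = F w) : IsContinuation a G Q := by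
  obtain ⟨τ, hτ⟩ := h.exists_eq
  obtain ⟨τ', hτ'⟩ := hFG
  refine ⟨hG, hG', max τ τ', fun w hw => ?_⟩
  obtain ⟨h1, h2⟩ := hτ w (lt_of_le_of_lt (le_max_left _ _) hw)
  exact ⟨h1, by rw [hτ' w (lt_of_le_of_lt (le_max_right _ _) hw), h2]⟩

/-- The monomial Dirichlet series `c d^{-w}`. -/
theorem single {d : ℕ} (hd : d ≠ 0) (c : ℂ) :
    IsContinuation (fun n => if n = d then c else 0) (fun w => c * (d : ℂ) ^ (-w)) P := by
  have hana : ∀ w : ℂ, AnalyticAt ℂ (fun w : ℂ => c * (d : ℂ) ^ (-w)) w := by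
    intro w
    refine analyticAt_const.fun_mul (AnalyticAt.cpow analyticAt_const analyticAt_id.fun_neg ?_)
    simpa using hd
  refine ⟨fun w _ => (hana w).meromorphicAt, fun w _ _ => hana w, 0, fun w _ => ?_⟩
  have ht : ∀ n, n ≠ d → LSeries.term (fun n => if n = d then c else 0) w n = 0 := by
    intro n hn
    simp [LSeries.term, hn]
  refine ⟨summable_of_ne_finset_zero (s := {d}) fun n hn => ht n (by simpa using hn), ?_⟩
  rw [LSeries, tsum_eq_single d ht, LSeries.term_of_ne_zero hd, cpow_neg]
  simp [div_eq_mul_inv]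

end IsContinuation

/-- Shifting the variable of a Dirichlet series. -/
theorem LSeries_term_mul_cpow_neg (f : ℕ → ℂ) (α w : ℂ) :
    LSeries.term (fun n => f n * (n : ℂ) ^ (-α)) w = LSeries.term f (w + α) := by
  ext n
  rcases eq_or_ne n 0 with rfl | hn
  · simp
  · have hn' : (n : ℂ) ≠ 0 := by exact_mod_cast hn
    rw [LSeries.term_of_ne_zero hn, LSeries.term_of_ne_zero hn, cpow_add _ _ hn', cpow_neg]
    field_simp

theorem LSeriesSummable_mul_cpow_neg_iff (f : ℕ → ℂ) (α w : ℂ) :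
    LSeriesSummable (fun n => f n * (n : ℂ) ^ (-α)) w ↔ LSeriesSummable f (w + α) := by
  rw [LSeriesSummable, LSeriesSummable, LSeries_term_mul_cpow_neg]

theorem LSeries_mul_cpow_neg (f : ℕ → ℂ) (α w : ℂ) :
    LSeries (fun n => f n * (n : ℂ) ^ (-α)) w = LSeries f (w + α) := by
  rw [LSeries, LSeries, LSeries_term_mul_cpow_neg]

/-! ### Periodic twists of `n^{-α}` and of `μ(n) n^{-γ}`. -/

theorem powFun_apply {n : ℕ} (hn : n ≠ 0) (α : ℂ) : powFun α n = (n : ℂ) ^ (-α) := by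
  simp [powFun, hn]

theorem muPowFun_apply {n : ℕ} (hn : n ≠ 0) (γ : ℂ) :
    muPowFun γ n = (ArithmeticFunction.moebius n : ℂ) * (n : ℂ) ^ (-γ) := by
  simp [muPowFun, hn]

theorem ZMod_LFunction_meromorphicAt {N : ℕ} [NeZero N] (Φ : ZMod N → ℂ) (s : ℂ) :
    MeromorphicAt (ZMod.LFunction Φ) s := by
  have hd : ∀ z : ℂ, z ≠ 1 → DifferentiableAt ℂ (ZMod.LFunction Φ) z := fun z hz =>
    ZMod.differentiableAt_LFunction Φ z (Or.inl hz)
  by_cases hs : s = 1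
  · subst hs
    -- The pole is at most simple, but the exponent `2` is convenient: `(z - 1)^2 L(z)` tends to
    -- `0`, which is also its literal value at `1` whatever `L(1)` is defined to be, so continuity
    -- there is automatic.
    refine ⟨2, analyticAt_of_differentiable_on_punctured_nhds_of_continuousAt ?_ ?_⟩
    · filter_upwards [self_mem_nhdsWithin] with z hz
      exact DifferentiableAt.fun_smul (f := ZMod.LFunction Φ) (c := fun z : ℂ => (z - 1) ^ 2)
        (by fun_prop) (hd z hz)
    · rw [← continuousWithinAt_compl_self, ContinuousWithinAt]
      have h1 : Tendsto (fun z : ℂ => z - 1) (𝓝[≠] 1) (𝓝 0) := by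
        have : Tendsto (fun z : ℂ => z - 1) (𝓝 1) (𝓝 (1 - 1)) := by
          exact (continuous_sub_right (1 : ℂ)).tendsto 1
        rw [sub_self] at this
        exact this.mono_left nhdsWithin_le_nhds
      have h2 := h1.mul (ZMod.LFunction_residue_one Φ)
      simp only [zero_mul] at h2
      simp only [sub_self, smul_eq_mul]
      rw [zero_pow two_ne_zero, zero_mul]
      refine h2.congr fun z => by ring
  · have : ∀ᶠ z in 𝓝 s, DifferentiableAt ℂ (ZMod.LFunction Φ) z := by
      filter_upwards [isOpen_ne.mem_nhds hs] with z hz using hd z hz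
    exact (analyticAt_iff_eventually_differentiableAt.mpr this).meromorphicAt

theorem ZMod_LFunction_analyticAt {N : ℕ} [NeZero N] (Φ : ZMod N → ℂ) {s : ℂ} (hs : s ≠ 1) :
    AnalyticAt ℂ (ZMod.LFunction Φ) s := by
  rw [analyticAt_iff_eventually_differentiableAt]
  filter_upwards [isOpen_ne.mem_nhds hs] with z hz
  exact ZMod.differentiableAt_LFunction Φ z (Or.inl hz)

/-- The periodic twists of `n ↦ n^{-α}`. -/
theorem isContinuation_powFun {q : ℕ} [NeZero q] (α : ℂ) (Φ : ZMod q → ℂ) :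
    IsContinuation (fun n => powFun α n * Φ n) (fun w => ZMod.LFunction Φ (w + α)) {1 - α} := by
  have hsh : ∀ w : ℂ, AnalyticAt ℂ (fun w : ℂ => w + α) w := fun w => by fun_prop
  refine IsContinuation.congr (a := fun n => Φ n * (n : ℂ) ^ (-α)) ⟨fun w _ => ?_,
    fun w _ hw => ?_, 1 - α.re, fun w hw => ?_⟩ fun n hn => ?_
  · exact MeromorphicAt.comp_analyticAt (g := fun w : ℂ => w + α)
      (ZMod_LFunction_meromorphicAt Φ (w + α)) (hsh w)
  · refine (ZMod_LFunction_analyticAt Φ ?_).comp (hsh w)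
    intro h
    exact hw (by simp [← h])
  · have : 1 < (w + α).re := by rw [add_re]; linarith
    rw [LSeriesSummable_mul_cpow_neg_iff, LSeries_mul_cpow_neg]
    exact ⟨ZMod.LSeriesSummable_of_one_lt_re Φ this, ZMod.LFunction_eq_LSeries Φ this⟩
  · rw [powFun_apply hn, mul_comm]

open Classical in
/-- The reciprocal of a Dirichlet `L`-function, with value `0` at the pole. -/
noncomputable def invLFunction {N : ℕ} [NeZero N] (ψ : DirichletCharacter ℂ N) (s : ℂ) : ℂ :=
  if ψ = 1 ∧ s = 1 then 0 else (DirichletCharacter.LFunction ψ s)⁻¹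

/-- GRH is needed only inside the critical strip; on `Re s ≥ 1` non-vanishing is unconditional. -/
theorem GRH.LFunction_ne_zero (hGRH : GRH) {N : ℕ} [NeZero N] (ψ : DirichletCharacter ℂ N) {s : ℂ}
    (hs : 1 / 2 < s.re) (h : ψ ≠ 1 ∨ s ≠ 1) : DirichletCharacter.LFunction ψ s ≠ 0 := by
  rcases lt_or_ge s.re 1 with h1 | h1
  · intro h0
    have := hGRH N ψ s (by linarith) h1 h0
    linarith
  · exact DirichletCharacter.LFunction_ne_zero_of_one_le_re ψ h h1

/-- The pole of a principal `L`-function becomes a zero of the reciprocal, which is why the value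
`0` assigned there is the right one. So the Möbius factors contribute no poles at all in `Re s >
1/2`. -/
theorem GRH.analyticAt_invLFunction (hGRH : GRH) {N : ℕ} [NeZero N] (ψ : DirichletCharacter ℂ N)
    {s : ℂ} (hs : 1 / 2 < s.re) : AnalyticAt ℂ (invLFunction ψ) s := by
  by_cases h : ψ = 1 ∧ s = 1
  · obtain ⟨rfl, rfl⟩ := h
    have h1 : AnalyticAt ℂ (fun z => (z - 1) / DirichletCharacter.LFunctionTrivChar₁ N z) 1 :=
      AnalyticAt.fun_div (by fun_prop)
        (Differentiable.analyticAt (DirichletCharacter.differentiable_LFunctionTrivChar₁ N) 1)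
        (DirichletCharacter.LFunctionTrivChar₁_apply_one_ne_zero N)
    refine h1.congr (Eventually.of_forall fun z => ?_)
    by_cases hz : z = 1
    · simp [hz, invLFunction]
    · simp only [DirichletCharacter.LFunctionTrivChar₁, Function.update_of_ne hz, invLFunction, hz,
        and_false, if_false]
      rw [div_mul_eq_div_div, div_self (sub_ne_zero.mpr hz), one_div]
  · have h' : ψ ≠ 1 ∨ s ≠ 1 := not_and_or.mp h
    have hev : ∀ᶠ z in 𝓝 s, ψ ≠ 1 ∨ z ≠ 1 := by
      rcases h' with h' | h'
      · exact Eventually.of_forall fun z => Or.inl h'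
      · filter_upwards [isOpen_ne.mem_nhds h'] with z hz using Or.inr hz
    have hL : AnalyticAt ℂ (DirichletCharacter.LFunction ψ) s := by
      rw [analyticAt_iff_eventually_differentiableAt]
      filter_upwards [hev] with z hz
      exact DirichletCharacter.differentiableAt_LFunction ψ z hz.symm
    refine (hL.fun_inv (hGRH.LFunction_ne_zero ψ hs h')).congr ?_
    filter_upwards [hev] with z hz
    rw [invLFunction, if_neg (not_and_or.mpr hz)]

theorem LSeries_moebius_mul_char {N : ℕ} [NeZero N] (ψ : DirichletCharacter ℂ N) {s : ℂ}
    (hs : 1 < s.re) :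
    LSeriesSummable (fun n => ψ n * (ArithmeticFunction.moebius n : ℂ)) s ∧
      invLFunction ψ s = LSeries (fun n => ψ n * (ArithmeticFunction.moebius n : ℂ)) s := by
  refine ⟨ψ.LSeriesSummable_mul (ArithmeticFunction.LSeriesSummable_moebius_iff.mpr hs), ?_⟩
  have h1 := DirichletCharacter.LSeries.mul_mu_eq_one ψ hs
  have hs1 : s ≠ 1 := by rintro rfl; simp at hs
  rw [invLFunction, if_neg (by simp [hs1]), DirichletCharacter.LFunction_eq_LSeries ψ hs]
  exact inv_eq_of_mul_eq_one_right h1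

/-- The twists of `n ↦ μ(n) n^{-γ}` by Dirichlet characters. -/
theorem GRH.isContinuation_muPowFun_char (hGRH : GRH) {N : ℕ} [NeZero N]
    (ψ : DirichletCharacter ℂ N) {γ : ℂ} (hγ : 0 < γ.re) :
    IsContinuation (fun n => muPowFun γ n * ψ n) (fun w => invLFunction ψ (w + γ)) ∅ := by
  have hana : ∀ w : ℂ, 1 / 2 < w.re → AnalyticAt ℂ (fun w => invLFunction ψ (w + γ)) w := by
    intro w hw
    have h1 : AnalyticAt ℂ (fun w : ℂ => w + γ) w := by fun_prop
    exact (hGRH.analyticAt_invLFunction ψ (by rw [add_re]; linarith)).comp h1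
  refine IsContinuation.congr
    (a := fun n => (ψ n * (ArithmeticFunction.moebius n : ℂ)) * (n : ℂ) ^ (-γ))
    ⟨fun w hw => (hana w hw).meromorphicAt, fun w hw _ => hana w hw, 1, fun w hw => ?_⟩
    fun n hn => ?_
  · rw [LSeriesSummable_mul_cpow_neg_iff, LSeries_mul_cpow_neg]
    exact LSeries_moebius_mul_char ψ (by rw [add_re]; linarith)
  · rw [muPowFun_apply hn]; ring

theorem single_convolution_apply {d : ℕ} (hd : d ≠ 0) (c : ℂ) (g : ℕ → ℂ) {n : ℕ} (hn : n ≠ 0) :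
    LSeries.convolution (fun n => if n = d then c else 0) g n = if d ∣ n then c * g (n / d) else 0 := by
  rw [LSeries.convolution_def]
  simp only [ite_mul, zero_mul]
  rw [← Finset.sum_filter]
  split_ifs with h
  · obtain ⟨m, rfl⟩ := h
    have : {p ∈ (d * m).divisorsAntidiagonal | p.1 = d} = {(d, m)} := by
      ext ⟨x, y⟩
      simp only [Finset.mem_filter, Nat.mem_divisorsAntidiagonal, Finset.mem_singleton,
        Prod.mk.injEq]
      constructor
      · rintro ⟨⟨h1, -⟩, rfl⟩
        exact ⟨rfl, Nat.eq_of_mul_eq_mul_left (Nat.pos_of_ne_zero hd) h1⟩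
      · rintro ⟨rfl, rfl⟩
        exact ⟨⟨rfl, hn⟩, rfl⟩
    rw [this, Finset.sum_singleton, Nat.mul_div_cancel_left m (Nat.pos_of_ne_zero hd)]
  · refine Finset.sum_eq_zero fun p hp => ?_
    simp only [Finset.mem_filter, Nat.mem_divisorsAntidiagonal] at hp
    exact absurd ⟨p.2, by rw [← hp.2, hp.1.1]⟩ h

theorem powFun_mul {m n : ℕ} (hm : m ≠ 0) (hn : n ≠ 0) (α : ℂ) :
    powFun α (m * n) = powFun α m * powFun α n := by
  rw [powFun_apply (mul_ne_zero hm hn), powFun_apply hm, powFun_apply hn, Nat.cast_mul,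
    natCast_mul_natCast_cpow]

theorem muPowFun_mul_of_coprime {m n : ℕ} (hm : m ≠ 0) (hn : n ≠ 0) (h : Nat.Coprime m n)
    (γ : ℂ) : muPowFun γ (m * n) = muPowFun γ m * muPowFun γ n := by
  rw [muPowFun_apply (mul_ne_zero hm hn), muPowFun_apply hm, muPowFun_apply hn, Nat.cast_mul,
    natCast_mul_natCast_cpow, ArithmeticFunction.isMultiplicative_moebius.map_mul_of_coprime h]
  push_cast
  ring

/-- The part of `n ↦ n^{-α}` supported on `gcd(n, q) = d`. -/
theorem powFun_gcd_eq {q d : ℕ} (hq : q ≠ 0) (hd : d ∣ q) (α : ℂ) {n : ℕ} (hn : n ≠ 0) :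
    (if n.gcd q = d then powFun α n else 0) =
      LSeries.convolution (fun n => if n = d then powFun α d else 0)
        (fun m => if m.Coprime (q / d) then powFun α m else 0) n := by
  have hd0 : d ≠ 0 := ne_zero_of_dvd_ne_zero hq hd
  rw [single_convolution_apply hd0 _ _ hn]
  by_cases hdn : d ∣ n
  · obtain ⟨m, rfl⟩ := hdn
    obtain ⟨k, rfl⟩ := hd
    have hm : m ≠ 0 := right_ne_zero_of_mul hn
    rw [if_pos (dvd_mul_right d m), Nat.mul_div_cancel_left m (Nat.pos_of_ne_zero hd0),
      Nat.mul_div_cancel_left k (Nat.pos_of_ne_zero hd0), Nat.gcd_mul_left]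
    have : d * m.gcd k = d ↔ m.Coprime k := by
      rw [Nat.Coprime]
      exact ⟨fun h => Nat.eq_of_mul_eq_mul_left (Nat.pos_of_ne_zero hd0) (by rw [h, mul_one]),
        fun h => by rw [h, mul_one]⟩
    simp only [this, powFun_mul hd0 hm, mul_ite, mul_zero]
  · rw [if_neg hdn, if_neg]
    rintro rfl
    exact hdn (Nat.gcd_dvd_left n q)

/-- The part of `n ↦ μ(n) n^{-γ} Φ(n)` supported on `gcd(n, q) = d`. -/
theorem muPowFun_gcd_eq {q d : ℕ} (hq : q ≠ 0) (hd : d ∣ q) (γ : ℂ) (Φ : ℕ → ℂ) {n : ℕ}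
    (hn : n ≠ 0) :
    (if n.gcd q = d then muPowFun γ n * Φ n else 0) =
      LSeries.convolution (fun n => if n = d then muPowFun γ d else 0)
        (fun m => if m.Coprime q then muPowFun γ m * Φ (d * m) else 0) n := by
  have hd0 : d ≠ 0 := ne_zero_of_dvd_ne_zero hq hd
  rw [single_convolution_apply hd0 _ _ hn]
  by_cases hdn : d ∣ n
  · obtain ⟨m, rfl⟩ := hdn
    have hm : m ≠ 0 := right_ne_zero_of_mul hn
    rw [if_pos (dvd_mul_right d m), Nat.mul_div_cancel_left m (Nat.pos_of_ne_zero hd0)]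
    by_cases hmq : m.Coprime q
    · have hmd : d.Coprime m := (hmq.coprime_dvd_right hd).symm
      have hg : (d * m).gcd q = d := by
        rw [Nat.gcd_comm, Nat.Coprime.gcd_mul_right_cancel_right _ hmq, Nat.gcd_comm]
        exact Nat.gcd_eq_left hd
      rw [if_pos hg, if_pos hmq, muPowFun_mul_of_coprime hd0 hm hmd, mul_assoc]
    · rw [if_neg hmq, mul_zero]
      split_ifs with hg
      · obtain ⟨p, hp, hpm, hpq⟩ := Nat.Prime.not_coprime_iff_dvd.mp hmq
        -- A prime `p` dividing both `m` and `q` must already divide `d`, since otherwise `d * p`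
        -- would divide the gcd. Then `p^2 ∣ d * m` and the Möbius function vanishes: this is why
        -- coprimality to all of `q`, not just to `q / d`, appears.
        have hsq : ¬ Squarefree (d * m) := by
          intro hsq
          have hpd : ¬ p ∣ d := fun hpd =>
            hp.one_lt.ne' (Nat.isUnit_iff.mp (hsq p (mul_dvd_mul hpd hpm)))
          have hcop : Nat.Coprime d p := ((Nat.Prime.coprime_iff_not_dvd hp).mpr hpd).symm
          have h1 : d * p ∣ (d * m).gcd q :=
            Nat.dvd_gcd (mul_dvd_mul_left d hpm) (hcop.mul_dvd_of_dvd_of_dvd hd hpq)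
          rw [hg] at h1
          exact hpd ((dvd_mul_left p d).trans h1)
        rw [muPowFun_apply hn, ArithmeticFunction.moebius_eq_zero_of_not_squarefree hsq]
        simp
      · rfl
  · rw [if_neg hdn, if_neg]
    rintro rfl
    exact hdn (Nat.gcd_dvd_left n q)

/-- A function on the units modulo `q`, extended by zero, is a combination of characters. -/
theorem exists_eq_sum_char {q : ℕ} [NeZero q] (Φ : ZMod q → ℂ) :
    ∃ c : DirichletCharacter ℂ q → ℂ, ∀ m : ℕ,
      (if m.Coprime q then Φ m else 0) = ∑ ψ, c ψ * ψ m := by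
  classical
  -- These are the Fourier coefficients on the unit group; the identity is orthogonality of
  -- characters.
  refine ⟨fun ψ => (q.totient : ℂ)⁻¹ * ∑ r ∈ Finset.univ.filter (fun r : ZMod q => IsUnit r),
    Φ r * ψ r⁻¹, fun m => ?_⟩
  have hφ : (q.totient : ℂ) ≠ 0 := by
    exact_mod_cast (Nat.totient_pos.mpr (NeZero.pos q)).ne'
  have h1 : ∀ r ∈ Finset.univ.filter (fun r : ZMod q => IsUnit r),
      ∑ ψ : DirichletCharacter ℂ q, ψ r⁻¹ * ψ m = if r = m then (q.totient : ℂ) else 0 :=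
    fun r hr => DirichletCharacter.sum_char_inv_mul_char_eq ℂ (by simpa using hr) _
  calc (if m.Coprime q then Φ m else 0)
      = (q.totient : ℂ)⁻¹ * ∑ r ∈ Finset.univ.filter (fun r : ZMod q => IsUnit r),
          Φ r * (if r = m then (q.totient : ℂ) else 0) := by
        simp only [mul_ite, mul_zero, Finset.sum_ite_eq', Finset.mem_filter, Finset.mem_univ,
          true_and, ZMod.isUnit_iff_coprime]
        split_ifs
        · field_simp
        · simp
    _ = _ := by
        rw [Finset.sum_congr rfl fun r hr => by rw [← h1 r hr]]
        simp only [Finset.mul_sum, Finset.sum_mul]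
        rw [Finset.sum_comm]
        exact Finset.sum_congr rfl fun ψ _ => Finset.sum_congr rfl fun r _ => by ring

theorem sum_divisors_gcd_ite {q : ℕ} (hq : q ≠ 0) (n : ℕ) (x : ℂ) :
    ∑ d ∈ q.divisors, (if n.gcd q = d then x else 0) = x := by
  rw [Finset.sum_ite_eq, if_pos (Nat.mem_divisors.mpr ⟨Nat.gcd_dvd_right n q, hq⟩)]

/-- The periodic twists of `n ↦ μ(n) n^{-γ}`. -/
theorem GRH.exists_isContinuation_muPowFun (hGRH : GRH) {q : ℕ} [NeZero q] {γ : ℂ}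
    (hγ : 0 < γ.re) (Φ : ZMod q → ℂ) :
    ∃ F, IsContinuation (fun n => muPowFun γ n * Φ n) F ∅ := by
  have hq : q ≠ 0 := NeZero.ne q
  -- After `n = d m` with `m` prime to `q`, the twist seen by `m` is the dilate `x ↦ Φ (d x)`, to be
  -- expanded in characters for each `d` separately.
  choose c hc using fun d : ℕ => exists_eq_sum_char (fun x : ZMod q => Φ (d * x))
  have h1 : ∀ d : ℕ, IsContinuation
      (fun m => if m.Coprime q then muPowFun γ m * Φ ((d * m : ℕ) : ZMod q) else 0)
      (fun w => ∑ ψ, c d ψ * invLFunction ψ (w + γ)) ∅ := by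
    intro d
    refine (IsContinuation.sum fun ψ _ =>
      (hGRH.isContinuation_muPowFun_char ψ hγ).const_mul (c d ψ)).congr fun n _ => ?_
    have := hc d n
    calc ∑ ψ, c d ψ * (muPowFun γ n * ψ n) = muPowFun γ n * ∑ ψ, c d ψ * ψ n := by
          rw [Finset.mul_sum]
          exact Finset.sum_congr rfl fun ψ _ => by ring
      _ = _ := by
          rw [← this]
          push_cast
          rw [mul_ite, mul_zero]
  refine ⟨_, (IsContinuation.sum (S := q.divisors) fun d hd =>
    ((IsContinuation.single (d := d) ?_ (muPowFun γ d)).convolution (h1 d)).congr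
      fun n hn => (muPowFun_gcd_eq hq (Nat.dvd_of_mem_divisors hd) γ
        (fun k => Φ (k : ZMod q)) hn).symm).congr fun n hn => ?_⟩
  · exact (Nat.pos_of_mem_divisors hd).ne'
  · exact sum_divisors_gcd_ite hq n _

/-! ### Convolutions of twists, and their residues. -/

/-- Periodic twists of a Dirichlet convolution. -/
theorem IsContinuation.mul_twist {q : ℕ} [NeZero q] {f g : ArithmeticFunction ℂ} {P : Set ℂ}
    {Φ : ZMod q → ℂ} {F G : ZMod q → ℂ → ℂ}
    (hF : ∀ r, IsContinuation (fun n => f n * if (n : ZMod q) = r then 1 else 0) (F r) P)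
    (hG : ∀ r, IsContinuation (fun n => g n * Φ (r * n)) (G r) P) :
    IsContinuation (fun n => (f * g) n * Φ n) (fun w => ∑ r, F r w * G r w) P := by
  -- Sorting the pairs `k * l = n` by the class `r` of `k` separates the variables, since `Φ (k l) =
  -- Φ (r l)`.
  refine (IsContinuation.sum fun r _ => (hF r).convolution (hG r)).congr fun n _ => ?_
  simp only [LSeries.convolution_def, ArithmeticFunction.mul_apply]
  rw [Finset.sum_comm, Finset.sum_mul]
  refine Finset.sum_congr rfl fun p hp => ?_
  rw [Finset.sum_eq_single (p.1 : ZMod q)]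
  · rw [if_pos rfl, mul_one, ← Nat.cast_mul, (Nat.mem_divisorsAntidiagonal.mp hp).1, mul_assoc]
  · intro r _ hr
    rw [if_neg (Ne.symm hr)]
    simp
  · simp

/-- All periodic twists of `f` modulo `q` continue to `1 / 2 < re w`, analytically off `P`. -/
def TwistsContinue (q : ℕ) (f : ArithmeticFunction ℂ) (P : Set ℂ) : Prop :=
  ∀ Φ : ZMod q → ℂ, ∃ F, IsContinuation (fun n => f n * Φ n) F P

/-- Quantifying over all periodic `Φ` makes the property stable: one factor is twisted by indicators
of residue classes, the other by dilates of `Φ`. -/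
theorem TwistsContinue.mul {q : ℕ} [NeZero q] {f g : ArithmeticFunction ℂ} {P Q : Set ℂ}
    (hf : TwistsContinue q f P) (hg : TwistsContinue q g Q) : TwistsContinue q (f * g) (P ∪ Q) := by
  intro Φ
  choose F hF using fun r => hf fun x => if x = r then 1 else 0
  choose G hG using fun r => hg fun x => Φ (r * x)
  exact ⟨_, IsContinuation.mul_twist (fun r => (hF r).mono Set.subset_union_left)
    fun r => (hG r).mono Set.subset_union_right⟩

theorem TwistsContinue.one (q : ℕ) (P : Set ℂ) : TwistsContinue q 1 P := by
  intro Φ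
  refine ⟨_, (IsContinuation.single one_ne_zero (Φ 1)).congr fun n _ => ?_⟩
  rw [ArithmeticFunction.one_apply]
  split_ifs with h <;> simp [h]

theorem twistsContinue_prod_powFun {q : ℕ} [NeZero q] (A : Finset ℂ) :
    TwistsContinue q (∏ α ∈ A, powFun α) {w | 1 - w ∈ A} := by
  classical
  induction A using Finset.induction_on with
  | empty => simpa using TwistsContinue.one q _
  | insert α A hα ih =>
    rw [Finset.prod_insert hα]
    have h1 : TwistsContinue q (powFun α) {1 - α} := fun Φ => ⟨_, isContinuation_powFun α Φ⟩
    intro Φ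
    obtain ⟨F, hF⟩ := h1.mul ih Φ
    refine ⟨F, hF.mono ?_⟩
    rintro w (hw | hw)
    · simp [Set.mem_singleton_iff.mp hw]
    · exact Finset.mem_insert_of_mem hw

theorem GRH.twistsContinue_prod_muPowFun (hGRH : GRH) {q : ℕ} [NeZero q] (C : Finset ℂ)
    (hC : ∀ γ ∈ C, 0 < γ.re) : TwistsContinue q (∏ γ ∈ C, muPowFun γ) ∅ := by
  classical
  induction C using Finset.induction_on with
  | empty => simpa using TwistsContinue.one q _
  | insert γ C hγ ih =>
    rw [Finset.prod_insert hγ]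
    have h1 : TwistsContinue q (muPowFun γ) ∅ := fun Φ =>
      hGRH.exists_isContinuation_muPowFun (hC γ (Finset.mem_insert_self _ _)) Φ
    simpa using h1.mul (ih fun c hc => hC c (Finset.mem_insert_of_mem hc))

theorem GRH.twistsContinue_I (hGRH : GRH) {q : ℕ} [NeZero q] (A C : Finset ℂ)
    (hC : ∀ γ ∈ C, 0 < γ.re) : TwistsContinue q (I A C) {w | 1 - w ∈ A} := by
  simpa [I] using (twistsContinue_prod_powFun A).mul (hGRH.twistsContinue_prod_muPowFun C hC)

theorem I_eq_powFun_mul {A C : Finset ℂ} {α : ℂ} (hα : α ∈ A) :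
    I A C = powFun α * I (A.erase α) C := by
  rw [I, I, ← mul_assoc, Finset.mul_prod_erase A _ hα]

/-- The residue of a periodic twist at the pole coming from the factor `n ↦ n^{-α}`. -/
theorem tendsto_sub_mul_continuedLSeries {q : ℕ} [NeZero q] {g : ArithmeticFunction ℂ} {α : ℂ}
    {Q : Set ℂ} (hQ : IsClosed Q) (hα : 1 / 2 < (1 - α).re) (hαQ : 1 - α ∉ Q)
    (hg : TwistsContinue q g Q) (Φ : ZMod q → ℂ) :
    Tendsto (fun w => (w - (1 - α)) * continuedLSeries (fun n => (powFun α * g) n * Φ n) w)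
      (𝓝[≠] (1 - α))
      (𝓝 (continuedLSeries (fun n => g n * ((∑ r, Φ (r * n)) / q)) (1 - α))) := by
  choose G hG using fun r => hg fun x => Φ (r * x)
  have hF := fun r : ZMod q => isContinuation_powFun α fun x : ZMod q => if x = r then 1 else 0
  have hprod : IsContinuation (fun n => (powFun α * g) n * Φ n) _ ({1 - α} ∪ Q) :=
    IsContinuation.mul_twist (fun r => (hF r).mono Set.subset_union_left)
      fun r => (hG r).mono Set.subset_union_right
  have hval : continuedLSeries (fun n => g n * ((∑ r, Φ (r * n)) / q)) (1 - α) =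
      ∑ r, (q : ℂ)⁻¹ * G r (1 - α) := by
    refine IsContinuation.continuedLSeries_eq (P := Q) ?_ hα hαQ (F := fun w => ∑ r, (q : ℂ)⁻¹ * G r w)
    refine (IsContinuation.sum fun r _ => (hG r).const_mul (q : ℂ)⁻¹).congr fun n _ => ?_
    rw [div_eq_mul_inv, Finset.sum_mul, Finset.mul_sum]
    exact Finset.sum_congr rfl fun r _ => by ring
  rw [hval]
  -- Every residue class has density `1 / q`, so all classes contribute the same residue, and the
  -- residues combine to the average of `Φ (r n)` over `r`.
  have hres : ∀ r : ZMod q, Tendsto (fun w : ℂ => (w - (1 - α)) *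
      ZMod.LFunction (fun x : ZMod q => if x = r then 1 else 0) (w + α)) (𝓝[≠] (1 - α))
      (𝓝 (q : ℂ)⁻¹) := by
    intro r
    have hsh : Tendsto (fun w : ℂ => w + α) (𝓝[≠] (1 - α)) (𝓝[≠] 1) := by
      refine tendsto_nhdsWithin_of_tendsto_nhds_of_eventually_within _ ?_ ?_
      · have : Tendsto (fun w : ℂ => w + α) (𝓝 (1 - α)) (𝓝 (1 - α + α)) :=
          (continuous_add_const α).tendsto _
        rw [sub_add_cancel] at this
        exact this.mono_left nhdsWithin_le_nhds
      · filter_upwards [self_mem_nhdsWithin] with w hw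
        intro h
        exact hw (eq_sub_of_add_eq h)
    have h1 := (ZMod.LFunction_residue_one
      (fun x : ZMod q => if x = r then (1 : ℂ) else 0)).comp hsh
    have h2 : ∑ j : ZMod q, (if j = r then (1 : ℂ) else 0) / q = (q : ℂ)⁻¹ := by
      rw [← Finset.sum_div]; simp
    rw [h2] at h1
    refine h1.congr fun w => ?_
    simp only [Function.comp]
    congr 1
    ring
  have hlim : Tendsto (fun w : ℂ => ∑ r, ((w - (1 - α)) *
      ZMod.LFunction (fun x : ZMod q => if x = r then 1 else 0) (w + α)) * G r w) (𝓝[≠] (1 - α))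
      (𝓝 (∑ r, (q : ℂ)⁻¹ * G r (1 - α))) :=
    tendsto_finsetSum _ fun r _ => (hres r).mul
      (((hG r).analyticAt _ hα hαQ).continuousAt.tendsto.mono_left nhdsWithin_le_nhds)
  refine hlim.congr' ?_
  have ho : IsOpen {w : ℂ | 1 / 2 < w.re} := isOpen_lt continuous_const continuous_re
  filter_upwards [self_mem_nhdsWithin, mem_nhdsWithin_of_mem_nhds (ho.mem_nhds hα),
    mem_nhdsWithin_of_mem_nhds (hQ.isOpen_compl.mem_nhds hαQ)] with w hw1 hw2 hw3
  rw [hprod.continuedLSeries_eq hw2 (by rintro (h | h); exacts [hw1 h, hw3 h]), Finset.mul_sum]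
  exact Finset.sum_congr rfl fun r _ => by ring

/-! ### Series over multiples of `q`: Euler factors and bounds uniform in `q`. -/

/-- The reciprocal of the Riemann zeta function, with value `0` at the pole. -/
noncomputable def invZeta (s : ℂ) : ℂ := invLFunction (1 : DirichletCharacter ℂ 1) s

/-- The function `∏ ζ(w + α) / ∏ ζ(w + γ)`. -/
noncomputable def zetaQuotient (A C : Finset ℂ) (w : ℂ) : ℂ :=
  (∏ α ∈ A, riemannZeta (w + α)) * ∏ γ ∈ C, invZeta (w + γ)

theorem riemannZeta_meromorphicAt (s : ℂ) : MeromorphicAt riemannZeta s := by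
  have := ZMod_LFunction_meromorphicAt (N := 1) (1 : DirichletCharacter ℂ 1) s
  have h := DirichletCharacter.LFunction_modOne_eq (χ := 1)
  rw [← h]
  exact this

theorem riemannZeta_analyticAt {s : ℂ} (hs : s ≠ 1) : AnalyticAt ℂ riemannZeta s := by
  rw [analyticAt_iff_eventually_differentiableAt]
  filter_upwards [isOpen_ne.mem_nhds hs] with z hz using differentiableAt_riemannZeta hz

theorem riemannZeta_add_meromorphicAt (α w : ℂ) :
    MeromorphicAt (fun w => riemannZeta (w + α)) w :=
  MeromorphicAt.comp_analyticAt (g := fun w : ℂ => w + α) (riemannZeta_meromorphicAt _)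
    (by fun_prop)

theorem riemannZeta_add_analyticAt {α w : ℂ} (h : w ≠ 1 - α) :
    AnalyticAt ℂ (fun w => riemannZeta (w + α)) w :=
  AnalyticAt.fun_comp (f := fun w : ℂ => w + α)
    (riemannZeta_analyticAt fun h' => h (eq_sub_of_add_eq h')) (by fun_prop)

theorem GRH.invZeta_add_analyticAt (hGRH : GRH) {γ w : ℂ} (hγ : 0 < γ.re) (hw : 1 / 2 < w.re) :
    AnalyticAt ℂ (fun w => invZeta (w + γ)) w :=
  AnalyticAt.fun_comp (g := invLFunction (1 : DirichletCharacter ℂ 1)) (f := fun w : ℂ => w + γ)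
    (hGRH.analyticAt_invLFunction _ (by rw [add_re]; linarith)) (by fun_prop)

theorem GRH.zetaQuotient_meromorphicAt (hGRH : GRH) {A C : Finset ℂ} (hC : ∀ γ ∈ C, 0 < γ.re)
    {w : ℂ} (hw : 1 / 2 < w.re) : MeromorphicAt (zetaQuotient A C) w :=
  (MeromorphicAt.fun_prod fun α _ => riemannZeta_add_meromorphicAt α w).fun_mul
    (MeromorphicAt.fun_prod fun γ hγ => (hGRH.invZeta_add_analyticAt (hC γ hγ) hw).meromorphicAt)

theorem GRH.zetaQuotient_analyticAt (hGRH : GRH) {A C : Finset ℂ} (hC : ∀ γ ∈ C, 0 < γ.re)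
    {w : ℂ} (hw : 1 / 2 < w.re) (hwA : 1 - w ∉ A) : AnalyticAt ℂ (zetaQuotient A C) w := by
  refine (Finset.analyticAt_fun_prod _ fun α hα => riemannZeta_add_analyticAt ?_).fun_mul
    (Finset.analyticAt_fun_prod _ fun γ hγ => hGRH.invZeta_add_analyticAt (hC γ hγ) hw)
  rintro rfl
  exact hwA (by simpa using hα)

theorem one_char_natCast {N : ℕ} (m : ℕ) :
    (1 : DirichletCharacter ℂ N) (m : ZMod N) = if m.Coprime N then 1 else 0 := by
  split_ifs with h
  · exact MulChar.one_apply ((ZMod.isUnit_iff_coprime m N).mpr h)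
  · exact MulChar.map_nonunit _ fun h' => h ((ZMod.isUnit_iff_coprime m N).mp h')

theorem natCast_cpow_neg_analyticAt {n : ℕ} (hn : n ≠ 0) (α w : ℂ) :
    AnalyticAt ℂ (fun w : ℂ => (n : ℂ) ^ (-(w + α))) w := by
  refine AnalyticAt.cpow analyticAt_const (by fun_prop) ?_
  simpa using hn

/-- The finite Euler product `∏_{p ∣ q} (1 - p^{-s})`. -/
noncomputable def eulerProd (q : ℕ) (s : ℂ) : ℂ := ∏ p ∈ q.primeFactors, (1 - (p : ℂ) ^ (-s))

theorem eulerProd_add_analyticAt (q : ℕ) (α w : ℂ) :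
    AnalyticAt ℂ (fun w => eulerProd q (w + α)) w :=
  Finset.analyticAt_fun_prod _ fun _ hp => analyticAt_const.fun_sub
    (natCast_cpow_neg_analyticAt (Nat.prime_of_mem_primeFactors hp).ne_zero α w)

/-- Each prime factor contributes a factor `v + 1 ≥ 2` to the divisor count. This turns every
bounded Euler factor over `p ∣ q` into a power of `τ(q)`. -/
theorem two_pow_card_primeFactors_le {q : ℕ} (hq : q ≠ 0) :
    (2 : ℝ) ^ q.primeFactors.card ≤ q.divisors.card := by
  rw [Nat.card_divisors hq]
  push_cast
  rw [← Finset.prod_const]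
  refine Finset.prod_le_prod (fun _ _ => by norm_num) fun p hp => ?_
  have : 1 ≤ q.factorization p := (Nat.prime_of_mem_primeFactors hp).factorization_pos_of_dvd hq
    (Nat.dvd_of_mem_primeFactors hp)
  have : (1 : ℝ) ≤ q.factorization p := by exact_mod_cast this
  linarith

theorem norm_natCast_cpow_neg {n : ℕ} (hn : n ≠ 0) (s : ℂ) :
    ‖(n : ℂ) ^ (-s)‖ = (n : ℝ) ^ (-s.re) := by
  rw [norm_natCast_cpow_of_pos (Nat.pos_of_ne_zero hn), neg_re]

theorem norm_eulerProd_le {q : ℕ} (hq : q ≠ 0) {s : ℂ} (hs : 0 ≤ s.re) :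
    ‖eulerProd q s‖ ≤ q.divisors.card := by
  refine le_trans ?_ (two_pow_card_primeFactors_le hq)
  rw [eulerProd, norm_prod, ← Finset.prod_const]
  refine Finset.prod_le_prod (fun _ _ => norm_nonneg _) fun p hp => ?_
  have hp' := Nat.prime_of_mem_primeFactors hp
  have : ‖(p : ℂ) ^ (-s)‖ ≤ 1 := by
    rw [norm_natCast_cpow_neg hp'.ne_zero]
    exact Real.rpow_le_one_of_one_le_of_nonpos (by exact_mod_cast hp'.one_le) (by linarith)
  calc ‖1 - (p : ℂ) ^ (-s)‖ ≤ ‖(1 : ℂ)‖ + ‖(p : ℂ) ^ (-s)‖ := norm_sub_le _ _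
    _ ≤ 2 := by rw [norm_one]; linarith

/-- The worst case is `p = 2` on the line `Re s = 1/2`, where `2^{-1/2} ≤ 3/4`. -/
theorem quarter_le_norm_euler_factor {p : ℕ} (hp : p.Prime) {s : ℂ} (hs : 1 / 2 ≤ s.re) :
    1 / 4 ≤ ‖1 - (p : ℂ) ^ (-s)‖ := by
  have h2 : (2 : ℝ) ≤ p := by exact_mod_cast hp.two_le
  have h1 : ‖(p : ℂ) ^ (-s)‖ ≤ 3 / 4 := by
    rw [norm_natCast_cpow_neg hp.ne_zero]
    calc (p : ℝ) ^ (-s.re) ≤ (p : ℝ) ^ (-(1 / 2) : ℝ) :=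
          Real.rpow_le_rpow_of_exponent_le (by linarith) (by linarith)
      _ ≤ 2 ^ (-(1 / 2) : ℝ) := Real.rpow_le_rpow_of_nonpos (by norm_num) h2 (by norm_num)
      _ ≤ 3 / 4 := by
          rw [Real.rpow_neg (by norm_num), ← Real.sqrt_eq_rpow]
          have : (4 / 3 : ℝ) ≤ √2 := Real.le_sqrt_of_sq_le (by norm_num)
          calc (√2)⁻¹ ≤ (4 / 3 : ℝ)⁻¹ := inv_anti₀ (by norm_num) this
            _ = 3 / 4 := by norm_num
  have := norm_sub_norm_le (1 : ℂ) ((p : ℂ) ^ (-s))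
  rw [norm_one] at this
  linarith

theorem eulerProd_ne_zero (q : ℕ) {s : ℂ} (hs : 1 / 2 ≤ s.re) : eulerProd q s ≠ 0 :=
  Finset.prod_ne_zero_iff.mpr fun p hp => by
    have := quarter_le_norm_euler_factor (Nat.prime_of_mem_primeFactors hp) hs
    exact norm_pos_iff.mp (by linarith)

theorem norm_eulerProd_inv_le {q : ℕ} (hq : q ≠ 0) {s : ℂ} (hs : 1 / 2 ≤ s.re) :
    ‖(eulerProd q s)⁻¹‖ ≤ (q.divisors.card : ℝ) ^ 2 := by
  calc ‖(eulerProd q s)⁻¹‖ = ∏ p ∈ q.primeFactors, ‖1 - (p : ℂ) ^ (-s)‖⁻¹ := by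
        rw [eulerProd, norm_inv, norm_prod, Finset.prod_inv_distrib]
    _ ≤ ∏ p ∈ q.primeFactors, (4 : ℝ) := by
        refine Finset.prod_le_prod (fun _ _ => by positivity) fun p hp => ?_
        have := quarter_le_norm_euler_factor (Nat.prime_of_mem_primeFactors hp) hs
        calc ‖1 - (p : ℂ) ^ (-s)‖⁻¹ ≤ (1 / 4 : ℝ)⁻¹ := inv_anti₀ (by norm_num) this
          _ = 4 := by norm_num
    _ = ((2 : ℝ) ^ q.primeFactors.card) ^ 2 := by
        rw [Finset.prod_const, ← pow_mul, mul_comm, pow_mul]; norm_num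
    _ ≤ _ := by gcongr; exact two_pow_card_primeFactors_le hq

/-- The series `∑_{gcd(n, q) = d} n^{-α - w}`. -/
theorem isContinuation_powFun_gcd {q d : ℕ} (hq : q ≠ 0) (hd : d ∣ q) (α : ℂ) :
    IsContinuation (fun n => if n.gcd q = d then powFun α n else 0)
      (fun w => riemannZeta (w + α) * ((d : ℂ) ^ (-(w + α)) * eulerProd (q / d) (w + α)))
      {1 - α} := by
  have hd0 : d ≠ 0 := ne_zero_of_dvd_ne_zero hq hd
  have : NeZero (q / d) := ⟨(Nat.div_pos (Nat.le_of_dvd (Nat.pos_of_ne_zero hq) hd)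
    (Nat.pos_of_ne_zero hd0)).ne'⟩
  have h1 := isContinuation_powFun α (fun x => (1 : DirichletCharacter ℂ (q / d)) x)
  have h2 : IsContinuation (fun m => if m.Coprime (q / d) then powFun α m else 0)
      (fun w => ZMod.LFunction (fun x => (1 : DirichletCharacter ℂ (q / d)) x) (w + α)) {1 - α} :=
    h1.congr fun n _ => by rw [one_char_natCast, mul_ite, mul_one, mul_zero]
  have h3 := ((IsContinuation.single hd0 (powFun α d)).convolution h2).congr
    fun n hn => (powFun_gcd_eq hq hd α hn).symm
  have hdana : ∀ w : ℂ, AnalyticAt ℂ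
      (fun w => (d : ℂ) ^ (-(w + α)) * eulerProd (q / d) (w + α)) w := fun w =>
    (natCast_cpow_neg_analyticAt hd0 α w).fun_mul (eulerProd_add_analyticAt _ α w)
  refine h3.of_eq (fun w _ => (riemannZeta_add_meromorphicAt α w).fun_mul (hdana w).meromorphicAt)
    (fun w _ hw => (riemannZeta_add_analyticAt hw).fun_mul (hdana w)) ⟨1 - α.re, fun w hw => ?_⟩
  have hne : w + α ≠ 1 := by
    intro h
    have := congrArg re h
    rw [add_re, one_re] at this
    linarith
  have h4 := DirichletCharacter.LFunctionTrivChar_eq_mul_riemannZeta (N := q / d) hne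
  rw [DirichletCharacter.LFunctionTrivChar, DirichletCharacter.LFunction] at h4
  rw [h4, powFun_apply hd0, eulerProd, neg_add, cpow_add _ _ (by exact_mod_cast hd0)]
  ring

/-- The series `∑_{gcd(n, q) = d} μ(n) n^{-γ - w}`. -/
theorem GRH.isContinuation_muPowFun_gcd (hGRH : GRH) {q d : ℕ} (hq : q ≠ 0) (hd : d ∣ q) {γ : ℂ}
    (hγ : 0 < γ.re) :
    IsContinuation (fun n => if n.gcd q = d then muPowFun γ n else 0)
      (fun w => invZeta (w + γ) * ((ArithmeticFunction.moebius d : ℂ) * (d : ℂ) ^ (-(w + γ)) *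
        (eulerProd q (w + γ))⁻¹)) ∅ := by
  have hd0 : d ≠ 0 := ne_zero_of_dvd_ne_zero hq hd
  have : NeZero q := ⟨hq⟩
  have h1 := hGRH.isContinuation_muPowFun_char (1 : DirichletCharacter ℂ q) hγ
  have h2 : IsContinuation (fun m => if m.Coprime q then muPowFun γ m * 1 else 0) _ ∅ :=
    h1.congr fun n _ => by rw [one_char_natCast, mul_ite, mul_zero]
  have h3 := ((IsContinuation.single hd0 (muPowFun γ d)).convolution h2).congr
    fun n hn => (muPowFun_gcd_eq hq hd γ (fun _ => 1) hn).symm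
  have h3' := h3.congr (b := fun n => if n.gcd q = d then muPowFun γ n else 0)
    fun n _ => by simp
  have hana : ∀ w : ℂ, 1 / 2 < w.re → AnalyticAt ℂ
      (fun w => invZeta (w + γ) * ((ArithmeticFunction.moebius d : ℂ) * (d : ℂ) ^ (-(w + γ)) *
        (eulerProd q (w + γ))⁻¹)) w := fun w hw =>
    (hGRH.invZeta_add_analyticAt hγ hw).fun_mul
      ((analyticAt_const.fun_mul (natCast_cpow_neg_analyticAt hd0 γ w)).fun_mul
        ((eulerProd_add_analyticAt q γ w).fun_inv
          (eulerProd_ne_zero q (by rw [add_re]; linarith))))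
  refine h3'.of_eq (fun w hw => (hana w hw).meromorphicAt) (fun w hw _ => hana w hw)
    ⟨1, fun w hw => ?_⟩
  have hne : w + γ ≠ 1 := by
    intro h
    have := congrArg re h
    rw [add_re, one_re] at this
    linarith
  have h4 := DirichletCharacter.LFunctionTrivChar_eq_mul_riemannZeta (N := q) hne
  rw [DirichletCharacter.LFunctionTrivChar] at h4
  rw [invZeta, invLFunction, invLFunction, if_neg (by simp [hne]), if_neg (by simp [hne]), h4,
    DirichletCharacter.LFunction_modOne_eq, muPowFun_apply hd0, eulerProd, neg_add,
    cpow_add _ _ (by exact_mod_cast hd0), mul_inv]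
  ring

/-- The part of a Dirichlet convolution supported on multiples of `q`. -/
theorem IsContinuation.mul_dvd {q : ℕ} (hq : q ≠ 0) {f g : ArithmeticFunction ℂ} {P : Set ℂ}
    {F G : ℕ → ℂ → ℂ}
    (hF : ∀ d, d ∣ q → IsContinuation (fun n => if n.gcd q = d then f n else 0) (F d) P)
    (hG : ∀ d, d ∣ q → IsContinuation (fun n => if d ∣ n then g n else 0) (G d) P) :
    IsContinuation (fun n => if q ∣ n then (f * g) n else 0)
      (fun w => ∑ d ∈ q.divisors, F d w * G (q / d) w) P := by
  refine (IsContinuation.sum fun d hd => (hF d (Nat.dvd_of_mem_divisors hd)).convolution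
    (hG (q / d) (Nat.div_dvd_of_dvd (Nat.dvd_of_mem_divisors hd)))).congr fun n hn => ?_
  simp only [LSeries.convolution_def, ArithmeticFunction.mul_apply]
  rw [Finset.sum_comm]
  have key : ∀ p ∈ n.divisorsAntidiagonal, ∑ d ∈ q.divisors,
      (if p.1.gcd q = d then f p.1 else 0) * (if q / d ∣ p.2 then g p.2 else 0) =
        if q ∣ n then f p.1 * g p.2 else 0 := by
    intro p hp
    obtain ⟨hpn, -⟩ := Nat.mem_divisorsAntidiagonal.mp hp
    -- Once the first factor has `gcd(k, q) = d`, the condition `q ∣ k l` bears on the second factor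
    -- alone, as `q / d ∣ l`.
    have hdvd : q / p.1.gcd q ∣ p.2 ↔ q ∣ n := by
      rw [Nat.div_dvd_iff_dvd_mul (Nat.gcd_dvd_right _ _)
        (Nat.gcd_pos_of_pos_right _ (Nat.pos_of_ne_zero hq)), Nat.gcd_comm,
        Nat.dvd_gcd_mul_iff_dvd_mul, hpn]
    rw [Finset.sum_eq_single (p.1.gcd q)]
    · simp only [if_true, hdvd, mul_ite, mul_zero]
    · intro d _ hd
      rw [if_neg (Ne.symm hd), zero_mul]
    · intro h
      exact absurd (Nat.mem_divisors.mpr ⟨Nat.gcd_dvd_right _ _, hq⟩) h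
  rw [Finset.sum_congr rfl key]
  split_ifs <;> simp

/-- The series of `f` over multiples of `q` is `Z ρ_q`, where `ρ_q` is analytic in `1 / 2 < re w`
and of size about `q^{-w - m}`. -/
def HasDvdFactor (f : ArithmeticFunction ℂ) (Z : ℂ → ℂ) (m : ℝ) (P : Set ℂ) : Prop :=
  ∃ (ρ : ℕ → ℂ → ℂ) (M : ℕ), ∀ q : ℕ, q ≠ 0 →
    (∀ w : ℂ, 1 / 2 < w.re → AnalyticAt ℂ (ρ q) w) ∧
    (∀ w : ℂ, 1 / 2 < w.re → ‖ρ q w‖ ≤ (q.divisors.card : ℝ) ^ M * (q : ℝ) ^ (-w.re - m)) ∧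
    IsContinuation (fun n => if q ∣ n then f n else 0) (fun w => Z w * ρ q w) P

theorem HasDvdFactor.one (m : ℝ) : HasDvdFactor 1 (fun _ => 1) m ∅ := by
  refine ⟨fun q _ => if q = 1 then 1 else 0, 0, fun q hq => ⟨fun w _ => analyticAt_const,
    fun w _ => ?_, ?_⟩⟩
  · by_cases h : q = 1
    · simp [h]
    · simp only [h, if_false, norm_zero, pow_zero, one_mul]
      positivity
  · refine ((IsContinuation.single (P := ∅) one_ne_zero (if q = 1 then 1 else 0)).of_eq (Q := ∅)
      (G := fun _ => 1 * if q = 1 then 1 else 0) (fun w _ => analyticAt_const.meromorphicAt)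
      (fun w _ _ => analyticAt_const) ⟨0, fun w _ => by simp⟩).congr fun n _ => ?_
    rw [ArithmeticFunction.one_apply]
    by_cases h : n = 1 <;> simp [h]

/-- The bound is multiplicative in `q = d * (q / d)`: the factor `f` takes `d^{-Re w - m}` and `g`
takes `(q / d)^{-Re w - m}`, so the power of `q` is preserved exactly and only divisor functions are
lost. -/
theorem HasDvdFactor.mul {f g : ArithmeticFunction ℂ} {X Z : ℂ → ℂ} {m : ℝ} {P Q : Set ℂ} {K : ℕ}
    {κ : ℕ → ℕ → ℂ → ℂ} (hg : HasDvdFactor g Z m Q)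
    (hκ : ∀ q d, q ≠ 0 → d ∣ q → (∀ w : ℂ, 1 / 2 < w.re → AnalyticAt ℂ (κ q d) w) ∧
      (∀ w : ℂ, 1 / 2 < w.re →
        ‖κ q d w‖ ≤ (q.divisors.card : ℝ) ^ K * (d : ℝ) ^ (-w.re - m)) ∧
      IsContinuation (fun n => if n.gcd q = d then f n else 0) (fun w => X w * κ q d w) P) :
    HasDvdFactor (f * g) (fun w => X w * Z w) m (P ∪ Q) := by
  obtain ⟨ρ, M, hρ⟩ := hg
  have hdiv : ∀ {q d : ℕ}, q ≠ 0 → d ∈ q.divisors → q / d ≠ 0 := fun {q d} hq hd =>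
    (Nat.div_pos (Nat.divisor_le hd) (Nat.pos_of_mem_divisors hd)).ne'
  -- The extra `1` in the exponent counts the divisors `d` summed over.
  refine ⟨fun q w => ∑ d ∈ q.divisors, κ q d w * ρ (q / d) w, K + M + 1, fun q hq =>
    ⟨fun w hw => ?_, fun w hw => ?_, ?_⟩⟩
  · exact Finset.analyticAt_fun_sum _ fun d hd =>
      ((hκ q d hq (Nat.dvd_of_mem_divisors hd)).1 w hw).fun_mul ((hρ _ (hdiv hq hd)).1 w hw)
  · have hterm : ∀ d ∈ q.divisors, ‖κ q d w * ρ (q / d) w‖ ≤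
        (q.divisors.card : ℝ) ^ (K + M) * (q : ℝ) ^ (-w.re - m) := by
      intro d hd
      have hdq := Nat.dvd_of_mem_divisors hd
      have h1 := (hκ q d hq hdq).2.1 w hw
      have h2 := (hρ _ (hdiv hq hd)).2.1 w hw
      have h3 : ((q / d).divisors.card : ℝ) ≤ q.divisors.card := by
        exact_mod_cast Finset.card_le_card
          (Nat.divisors_subset_of_dvd hq (Nat.div_dvd_of_dvd hdq))
      have h4 : (q : ℝ) = (d : ℝ) * ((q / d : ℕ) : ℝ) := by
        exact_mod_cast (Nat.mul_div_cancel' hdq).symm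
      calc ‖κ q d w * ρ (q / d) w‖
          ≤ ((q.divisors.card : ℝ) ^ K * (d : ℝ) ^ (-w.re - m)) *
            ((q.divisors.card : ℝ) ^ M * ((q / d : ℕ) : ℝ) ^ (-w.re - m)) := by
            rw [norm_mul]
            refine mul_le_mul h1 (h2.trans ?_) (norm_nonneg _) (by positivity)
            gcongr
        _ = _ := by
            rw [h4, Real.mul_rpow (Nat.cast_nonneg _) (Nat.cast_nonneg _), pow_add]
            ring
    calc ‖∑ d ∈ q.divisors, κ q d w * ρ (q / d) w‖
        ≤ ∑ d ∈ q.divisors, (q.divisors.card : ℝ) ^ (K + M) * (q : ℝ) ^ (-w.re - m) :=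
          norm_sum_le_of_le _ hterm
      _ = _ := by rw [Finset.sum_const, nsmul_eq_mul, pow_succ]; ring
  · have h1 : ∀ d, d ∣ q → d ≠ 0 := fun d hd => ne_zero_of_dvd_ne_zero hq hd
    have := IsContinuation.mul_dvd hq
      (fun d hd => ((hκ q d hq hd).2.2).mono (Set.subset_union_left (t := Q)))
      (fun d hd => ((hρ d (h1 d hd)).2.2).mono (Set.subset_union_right (s := P)))
    refine this.congr_fun fun w => ?_
    rw [Finset.mul_sum]
    exact Finset.sum_congr rfl fun d _ => by ring

/-- Here the Euler product appears inverted, so its argument must stay in `Re ≥ 1/2`; `0 < Re γ`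
ensures this for `Re w > 1/2`. The loss is `4^{ω(q)} ≤ τ(q)^2`, whence `K = 2`. -/
theorem hasDvdFactor_prod_muPowFun (hGRH : GRH) (C : Finset ℂ) {m : ℝ}
    (hC : ∀ γ ∈ C, 0 < γ.re ∧ m ≤ γ.re) :
    HasDvdFactor (∏ γ ∈ C, muPowFun γ) (fun w => ∏ γ ∈ C, invZeta (w + γ)) m ∅ := by
  classical
  induction C using Finset.induction_on with
  | empty => simpa using HasDvdFactor.one m
  | insert γ C hγ ih =>
    obtain ⟨hγ0, hγm⟩ := hC γ (Finset.mem_insert_self _ _)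
    simp only [Finset.prod_insert hγ]
    rw [← Set.union_empty ∅]
    refine (ih fun c hc => hC c (Finset.mem_insert_of_mem hc)).mul (K := 2)
      (X := fun w => invZeta (w + γ))
      (κ := fun q d w => (ArithmeticFunction.moebius d : ℂ) * (d : ℂ) ^ (-(w + γ)) *
        (eulerProd q (w + γ))⁻¹)
      fun q d hq hd => ⟨fun w hw => ?_, fun w hw => ?_, hGRH.isContinuation_muPowFun_gcd hq hd hγ0⟩
    · exact (analyticAt_const.fun_mul (natCast_cpow_neg_analyticAt
        (ne_zero_of_dvd_ne_zero hq hd) γ w)).fun_mul ((eulerProd_add_analyticAt q γ w).fun_inv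
          (eulerProd_ne_zero q (by rw [add_re]; linarith)))
    · have hd0 : d ≠ 0 := ne_zero_of_dvd_ne_zero hq hd
      have hd1 : (1 : ℝ) ≤ d := by exact_mod_cast Nat.one_le_iff_ne_zero.mpr hd0
      have h1 : ‖(ArithmeticFunction.moebius d : ℂ)‖ ≤ 1 := by
        rw [norm_intCast]
        exact_mod_cast ArithmeticFunction.abs_moebius_le_one
      have h2 := norm_eulerProd_inv_le (q := q) hq (s := w + γ) (by rw [add_re]; linarith)
      have h3 : ‖(d : ℂ) ^ (-(w + γ))‖ ≤ (d : ℝ) ^ (-w.re - m) := by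
        rw [norm_natCast_cpow_neg hd0, add_re]
        exact Real.rpow_le_rpow_of_exponent_le hd1 (by linarith)
      rw [norm_mul, norm_mul, mul_comm]
      refine mul_le_mul h2 ?_ (by positivity) (by positivity)
      calc _ ≤ 1 * (d : ℝ) ^ (-w.re - m) := mul_le_mul h1 h3 (norm_nonneg _) zero_le_one
        _ = _ := one_mul _

/-- Here the Euler product is not inverted, so `Re (w + α) ≥ 0` suffices and one power of `τ(q)` is
lost. -/
theorem HasDvdFactor.prod_powFun_mul {g : ArithmeticFunction ℂ} {Z : ℂ → ℂ} {m : ℝ}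
    (hg : HasDvdFactor g Z m ∅) (A : Finset ℂ) (hA : ∀ α ∈ A, -(1 / 2) ≤ α.re ∧ m ≤ α.re) :
    HasDvdFactor ((∏ α ∈ A, powFun α) * g) (fun w => (∏ α ∈ A, riemannZeta (w + α)) * Z w) m
      {w | 1 - w ∈ A} := by
  classical
  induction A using Finset.induction_on with
  | empty => simpa using hg
  | insert α A hα ih =>
    obtain ⟨hα0, hαm⟩ := hA α (Finset.mem_insert_self _ _)
    simp only [Finset.prod_insert hα, mul_assoc]
    have hset : {w : ℂ | 1 - w ∈ insert α A} = {1 - α} ∪ {w | 1 - w ∈ A} := by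
      ext w
      have : 1 - w = α ↔ w = 1 - α :=
        ⟨fun h => by rw [← h, sub_sub_cancel], fun h => by rw [h, sub_sub_cancel]⟩
      simp [this]
    rw [hset]
    refine (ih fun c hc => hA c (Finset.mem_insert_of_mem hc)).mul (K := 1)
      (X := fun w => riemannZeta (w + α))
      (κ := fun q d w => (d : ℂ) ^ (-(w + α)) * eulerProd (q / d) (w + α))
      fun q d hq hd => ⟨fun w hw => ?_, fun w hw => ?_, isContinuation_powFun_gcd hq hd α⟩
    · exact (natCast_cpow_neg_analyticAt (ne_zero_of_dvd_ne_zero hq hd) α w).fun_mul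
        (eulerProd_add_analyticAt _ α w)
    · have hd0 : d ≠ 0 := ne_zero_of_dvd_ne_zero hq hd
      have hd1 : (1 : ℝ) ≤ d := by exact_mod_cast Nat.one_le_iff_ne_zero.mpr hd0
      have hqd : q / d ≠ 0 := (Nat.div_pos (Nat.le_of_dvd (Nat.pos_of_ne_zero hq) hd)
        (Nat.pos_of_ne_zero hd0)).ne'
      have h2 := norm_eulerProd_le hqd (s := w + α) (by rw [add_re]; linarith)
      have h2' : ((q / d).divisors.card : ℝ) ≤ q.divisors.card := by
        exact_mod_cast Finset.card_le_card
          (Nat.divisors_subset_of_dvd hq (Nat.div_dvd_of_dvd hd))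
      have h3 : ‖(d : ℂ) ^ (-(w + α))‖ ≤ (d : ℝ) ^ (-w.re - m) := by
        rw [norm_natCast_cpow_neg hd0, add_re]
        exact Real.rpow_le_rpow_of_exponent_le hd1 (by linarith)
      rw [norm_mul, mul_comm, pow_one]
      exact mul_le_mul (h2.trans h2') h3 (norm_nonneg _) (by positivity)

theorem GRH.hasDvdFactor_I (hGRH : GRH) (A C : Finset ℂ) {m : ℝ}
    (hA : ∀ α ∈ A, -(1 / 2) ≤ α.re ∧ m ≤ α.re) (hC : ∀ γ ∈ C, 0 < γ.re ∧ m ≤ γ.re) :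
    HasDvdFactor (I A C) (zetaQuotient A C) m {w | 1 - w ∈ A} :=
  (hasDvdFactor_prod_muPowFun hGRH C hC).prod_powFun_mul A hA

/-! ### Convergence of the majorants. -/

theorem card_divisors_mul_le (m n : ℕ) :
    (m * n).divisors.card ≤ m.divisors.card * n.divisors.card := by
  rw [Nat.divisors_mul]
  exact Finset.card_mul_le

/-- The Dirichlet series of a power of the divisor function converges for `1 < re s`. -/
theorem LSeriesSummable_card_divisors_pow (M : ℕ) {s : ℂ} (hs : 1 < s.re) :
    LSeriesSummable (fun n => (n.divisors.card : ℂ) ^ M) s := by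
  induction M with
  | zero =>
    simp only [pow_zero]
    exact LSeriesSummable_one_iff.mpr hs
  | succ M ih =>
    -- By submultiplicativity, `τ(n)^{M+1} = ∑_{d ∣ n} τ(n)^M ≤ ∑_{d ∣ n} τ(d)^M τ(n/d)^M`, so the
    -- next power is dominated by the self-convolution of the current one.
    have h := (ih.convolution ih).norm
    refine Summable.of_norm_bounded h fun n => LSeries.norm_term_le s ?_
    have h1 : LSeries.convolution (fun n : ℕ => (n.divisors.card : ℂ) ^ M)
        (fun n : ℕ => (n.divisors.card : ℂ) ^ M) n = ((∑ p ∈ n.divisorsAntidiagonal,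
          p.1.divisors.card ^ M * p.2.divisors.card ^ M : ℕ) : ℂ) := by
      rw [LSeries.convolution_def]; push_cast; rfl
    have h2 : (n.divisors.card : ℂ) ^ (M + 1) = ((n.divisors.card ^ (M + 1) : ℕ) : ℂ) := by
      push_cast; rfl
    rw [h1, h2, Complex.norm_natCast, Complex.norm_natCast]
    norm_cast
    calc n.divisors.card ^ (M + 1) = ∑ _p ∈ n.divisorsAntidiagonal, n.divisors.card ^ M := by
          rw [Finset.sum_const, smul_eq_mul, pow_succ, mul_comm]
          congr 1
          rw [← Nat.map_div_right_divisors, Finset.card_map]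
      _ ≤ _ := Finset.sum_le_sum fun p hp => by
          rw [← mul_pow, ← (Nat.mem_divisorsAntidiagonal.mp hp).1]
          exact Nat.pow_le_pow_left (card_divisors_mul_le _ _) M

theorem summable_card_divisors_pow_mul_rpow (M : ℕ) {σ : ℝ} (hσ : 1 < σ) :
    Summable fun q : ℕ => (q.divisors.card : ℝ) ^ M * (q : ℝ) ^ (-σ) := by
  refine (LSeriesSummable_card_divisors_pow M (s := σ) (by simpa using hσ)).norm.congr fun q => ?_
  rw [LSeries.norm_term_eq]
  split_ifs with hq
  · rw [hq, Nat.cast_zero, Real.zero_rpow (by linarith), mul_zero]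
  · rw [norm_pow, Complex.norm_natCast, ofReal_re, Real.rpow_neg (by positivity), div_eq_mul_inv]

/-! ### Ramanujan sums and the functional equation. -/

/-- The divisor sum `∑_{d ∣ q} μ(q / d) d^x`. -/
noncomputable def jordanSum (q : ℕ) (x : ℂ) : ℂ :=
  ∑ d ∈ q.divisors, (ArithmeticFunction.moebius (q / d) : ℂ) * (d : ℂ) ^ x

theorem jordanSum_analyticAt (q : ℕ) (x : ℂ) : AnalyticAt ℂ (jordanSum q) x := by
  refine Finset.analyticAt_fun_sum _ fun d hd => analyticAt_const.fun_mul
    (AnalyticAt.cpow analyticAt_const analyticAt_id ?_)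
  simpa using (Nat.pos_of_mem_divisors hd).ne'

theorem norm_jordanSum_le {q : ℕ} (hq : q ≠ 0) (x : ℂ) :
    ‖jordanSum q x‖ ≤ q.divisors.card * (1 + (q : ℝ) ^ x.re) := by
  have hq1 : (1 : ℝ) ≤ q := by exact_mod_cast Nat.one_le_iff_ne_zero.mpr hq
  rw [← nsmul_eq_mul, ← Finset.sum_const]
  refine norm_sum_le_of_le _ fun d hd => ?_
  have hd0 := Nat.pos_of_mem_divisors hd
  have hd1 : (1 : ℝ) ≤ d := by exact_mod_cast hd0
  have hdq : (d : ℝ) ≤ q := by exact_mod_cast Nat.divisor_le hd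
  have h1 : ‖(ArithmeticFunction.moebius (q / d) : ℂ)‖ ≤ 1 := by
    rw [norm_intCast]
    exact_mod_cast ArithmeticFunction.abs_moebius_le_one
  rw [norm_mul, norm_natCast_cpow_of_pos hd0]
  -- The exponent has no fixed sign: `d^x` is at most `q^x` if `Re x ≥ 0` and at most `1` otherwise.
  -- The sum of the two covers both cases.
  have h2 : (d : ℝ) ^ x.re ≤ 1 + (q : ℝ) ^ x.re := by
    have hpos : 0 < (q : ℝ) ^ x.re := Real.rpow_pos_of_pos (by linarith) _
    rcases le_total 0 x.re with h | h
    · have := Real.rpow_le_rpow (by linarith) hdq h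
      linarith
    · have := Real.rpow_le_one_of_one_le_of_nonpos hd1 h
      linarith
  calc _ ≤ 1 * (d : ℝ) ^ x.re := mul_le_mul_of_nonneg_right h1 (by positivity)
    _ ≤ _ := by rwa [one_mul]

/-- Möbius inversion: `∑_{q ∣ n} ∑_{d ∣ q} μ(q / d) d^x = n^x`. -/
theorem sum_divisors_jordanSum {n : ℕ} (hn : n ≠ 0) (x : ℂ) :
    ∑ q ∈ n.divisors, jordanSum q x = (n : ℂ) ^ x := by
  have h := (ArithmeticFunction.sum_eq_iff_sum_mul_moebius_eq (R := ℂ)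
    (f := fun q => jordanSum q x) (g := fun n => (n : ℂ) ^ x)).mpr ?_ n (Nat.pos_of_ne_zero hn)
  · exact h
  · intro q _
    rw [jordanSum, Nat.sum_divisorsAntidiagonal'
      (f := fun a b => (ArithmeticFunction.moebius a : ℂ) * (b : ℂ) ^ x)]

theorem e_natCast_div {q : ℕ} [NeZero q] (m : ℕ) :
    e ((m : ℂ) / q) = ZMod.stdAddChar (m : ZMod q) := by
  have := ZMod.toCircle_intCast (N := q) (m : ℤ)
  rw [ZMod.stdAddChar_apply]
  push_cast at this
  rw [this, e]
  congr 1
  ring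

theorem twist_eq (A C : Finset ℂ) (q : ℕ) [NeZero q] :
    twist A C q = fun n => I A C n * (ZMod.stdAddChar (n : ZMod q) : ℂ) := by
  ext n
  rw [twist, e_natCast_div]

theorem sum_stdAddChar_mul {q : ℕ} [NeZero q] (n : ℕ) :
    ∑ r : ZMod q, (ZMod.stdAddChar (r * (n : ZMod q)) : ℂ) = if q ∣ n then (q : ℂ) else 0 := by
  rw [AddChar.sum_mulShift (n : ZMod q) (ZMod.isPrimitive_stdAddChar q), ZMod.card]
  simp only [ZMod.natCast_eq_zero_iff]
  split_ifs <;> simp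

theorem sum_range_e {n : ℕ} (hn : n ≠ 0) (h : ℕ) :
    ∑ b ∈ Finset.range n, e ((b : ℂ) * h / n) = if n ∣ h then (n : ℂ) else 0 := by
  have : NeZero n := ⟨hn⟩
  rw [← sum_stdAddChar_mul]
  refine Finset.sum_bij' (fun b _ => (b : ZMod n)) (fun r _ => r.val) (fun _ _ => Finset.mem_univ _)
    (fun r _ => Finset.mem_range.mpr (ZMod.val_lt r)) (fun b hb => ?_) (fun r _ => ?_)
    (fun b _ => ?_)
  · exact ZMod.val_natCast_of_lt (Finset.mem_range.mp hb)
  · exact ZMod.natCast_zmod_val r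
  · rw [← Nat.cast_mul, ← Nat.cast_mul, e_natCast_div]

/-- Writing each fraction `b / n` in lowest terms `a / q` groups the `n`-th roots of unity by their
exact order `q ∣ n`. -/
theorem sum_divisors_ramanujanSum {n : ℕ} (hn : n ≠ 0) (h : ℕ) :
    ∑ q ∈ n.divisors, ramanujanSum q h = ∑ b ∈ Finset.range n, e ((b : ℂ) * h / n) := by
  have hn0 := Nat.pos_of_ne_zero hn
  have hg : ∀ b : ℕ, 0 < b.gcd n := fun b => Nat.gcd_pos_of_pos_right _ hn0
  simp only [ramanujanSum]
  rw [Finset.sum_sigma']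
  refine Finset.sum_bij' (fun x _ => x.2 * (n / x.1)) (fun b _ => ⟨n / b.gcd n, b / b.gcd n⟩)
    ?_ ?_ ?_ ?_ ?_
  · rintro ⟨q, a⟩ hx
    simp only [Finset.mem_sigma, Finset.mem_filter, Finset.mem_range, Nat.mem_divisors] at hx ⊢
    obtain ⟨⟨⟨k, rfl⟩, -⟩, ha, -⟩ := hx
    have hq : 0 < q := by omega
    rw [Nat.mul_div_cancel_left k hq]
    exact Nat.mul_lt_mul_of_pos_right ha (Nat.pos_of_mul_pos_left hn0)
  · intro b hb
    simp only [Finset.mem_sigma, Finset.mem_filter, Finset.mem_range, Nat.mem_divisors] at hb ⊢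
    refine ⟨⟨Nat.div_dvd_of_dvd (Nat.gcd_dvd_right _ _), hn⟩, ?_,
      Nat.coprime_div_gcd_div_gcd (hg b)⟩
    exact Nat.div_lt_div_of_lt_of_dvd (Nat.gcd_dvd_right _ _) hb
  · rintro ⟨q, a⟩ hx
    simp only [Finset.mem_sigma, Finset.mem_filter, Finset.mem_range, Nat.mem_divisors] at hx
    obtain ⟨⟨⟨k, rfl⟩, -⟩, ha, hc⟩ := hx
    have hq : 0 < q := by omega
    have hk : 0 < k := Nat.pos_of_mul_pos_left hn0
    have h1 : (a * k).gcd (q * k) = k := by rw [Nat.gcd_mul_right, hc.gcd_eq_one, one_mul]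
    simp only [Nat.mul_div_cancel_left k hq, h1, Nat.mul_div_cancel _ hk]
  · intro b _
    dsimp only
    rw [Nat.div_div_self (Nat.gcd_dvd_right _ _) hn, Nat.div_mul_cancel (Nat.gcd_dvd_left _ _)]
  · rintro ⟨q, a⟩ hx
    simp only [Finset.mem_sigma, Finset.mem_filter, Finset.mem_range, Nat.mem_divisors] at hx
    obtain ⟨⟨⟨k, rfl⟩, -⟩, ha, -⟩ := hx
    have hq : 0 < q := by omega
    have hk : 0 < k := Nat.pos_of_mul_pos_left hn0
    have hq' : (q : ℂ) ≠ 0 := by exact_mod_cast hq.ne'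
    have hk' : (k : ℂ) ≠ 0 := by exact_mod_cast hk.ne'
    simp only [Nat.mul_div_cancel_left k hq]
    push_cast
    congr 1
    field_simp

/-- Evaluation of Ramanujan's sum as a divisor sum. -/
theorem ramanujanSum_eq {q : ℕ} (hq : q ≠ 0) (h : ℕ) :
    ramanujanSum q h = ∑ d ∈ q.divisors,
      if d ∣ h then (ArithmeticFunction.moebius (q / d) : ℂ) * d else 0 := by
  have key : ∀ n : ℕ, 0 < n → ∑ q ∈ n.divisors, ramanujanSum q h = if n ∣ h then (n : ℂ) else 0 := by
    intro n hn
    rw [sum_divisors_ramanujanSum hn.ne', sum_range_e hn.ne']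
  have := (ArithmeticFunction.sum_eq_iff_sum_mul_moebius_eq (R := ℂ)
    (f := fun q => ramanujanSum q h) (g := fun n => if n ∣ h then (n : ℂ) else 0)).mp key q
      (Nat.pos_of_ne_zero hq)
  rw [← this, Nat.sum_divisorsAntidiagonal'
      (f := fun a b => (ArithmeticFunction.moebius a : ℂ) * if b ∣ h then (b : ℂ) else 0)]
  simp only [mul_ite, mul_zero]

theorem LSeriesHasSum_dvd {l : ℕ} (hl : l ≠ 0) {y : ℂ} (hy : 1 < y.re) :
    LSeriesHasSum (fun n => if l ∣ n then 1 else 0) y ((l : ℂ) ^ (-y) * riemannZeta y) := by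
  have ht : ∀ n, n ≠ l → LSeries.term (fun n => if n = l then 1 else 0) y n = 0 := by
    intro n hn
    simp [LSeries.term, hn]
  have h1 := hasSum_single l ht
  rw [LSeries.term_of_ne_zero hl, if_pos rfl, one_div, ← cpow_neg] at h1
  have h2 : LSeriesHasSum (fun n => if n = l then 1 else 0) y ((l : ℂ) ^ (-y)) := h1
  refine (LSeriesHasSum_congr y _ fun {n} hn => ?_).mp (h2.convolution (LSeriesHasSum_one hy))
  rw [single_convolution_apply hl _ _ hn]
  simp

/-- The Dirichlet series of Ramanujan's sums. -/
theorem hasContinuedValue_ramanujanSum {q : ℕ} (hq : q ≠ 0) {u : ℂ} (hu : u ≠ 1) :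
    HasContinuedValue (ramanujanSum q) u (riemannZeta u * jordanSum q (1 - u)) := by
  have hana : ∀ w : ℂ, AnalyticAt ℂ (fun w => jordanSum q (1 - w)) w := fun w =>
    AnalyticAt.fun_comp (f := fun w : ℂ => 1 - w) (jordanSum_analyticAt q _) (by fun_prop)
  refine ⟨fun w => riemannZeta w * jordanSum q (1 - w), u.re - 1, 1, by linarith,
    fun w _ => (riemannZeta_meromorphicAt w).fun_mul (hana w).meromorphicAt, fun w hw => ?_,
    (riemannZeta_analyticAt hu).fun_mul (hana u), rfl⟩
  have hd : ∀ d ∈ q.divisors, LSeriesHasSum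
      (((ArithmeticFunction.moebius (q / d) : ℂ) * d) • fun n => if d ∣ n then 1 else 0) w
      ((ArithmeticFunction.moebius (q / d) : ℂ) * d * ((d : ℂ) ^ (-w) * riemannZeta w)) :=
    fun d hd => (LSeriesHasSum_dvd (Nat.pos_of_mem_divisors hd).ne' hw).smul _
  have hs := LSeriesHasSum.sum hd
  have hs' : LSeriesHasSum (ramanujanSum q) w (riemannZeta w * jordanSum q (1 - w)) := by
    have hval : ∑ d ∈ q.divisors, (ArithmeticFunction.moebius (q / d) : ℂ) * d *
        ((d : ℂ) ^ (-w) * riemannZeta w) = riemannZeta w * jordanSum q (1 - w) := by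
      rw [jordanSum, Finset.mul_sum]
      refine Finset.sum_congr rfl fun d hd => ?_
      have hd0 : (d : ℂ) ≠ 0 := by exact_mod_cast (Nat.pos_of_mem_divisors hd).ne'
      rw [sub_eq_add_neg, cpow_add _ _ hd0, cpow_one]
      ring
    rw [← hval]
    refine (LSeriesHasSum_congr w _ fun {n} _ => ?_).mp hs
    rw [Finset.sum_apply, ramanujanSum_eq hq]
    exact Finset.sum_congr rfl fun d hd => by simp
  exact ⟨hs'.LSeriesSummable, hs'.LSeries_eq.symm⟩

/-- The asymmetric functional equation. -/
theorem chi_one_sub_mul_riemannZeta {u : ℂ} (hu : 0 < u.re) (hu1 : u ≠ 1) :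
    chi (1 - u) * riemannZeta u = riemannZeta (1 - u) := by
  have h := riemannZeta_one_sub (s := u) (fun n hn => ?_) hu1
  · rw [h, chi]
    have h1 : (2 : ℂ) ^ (1 - u) = 2 * 2 ^ (-u) := by
      rw [sub_eq_add_neg, cpow_add _ _ two_ne_zero, cpow_one]
    have h2 : ((2 : ℂ) * Real.pi) ^ (-u) = 2 ^ (-u) * (Real.pi : ℂ) ^ (-u) := by
      have := mul_cpow_ofReal_nonneg (a := 2) (b := Real.pi) (by norm_num) Real.pi_pos.le (-u)
      simpa using this
    have h3 : sin (Real.pi * (1 - u) / 2) = cos (Real.pi * u / 2) := by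
      rw [← sin_pi_div_two_sub]
      congr 1
      ring
    have h4 : (1 : ℂ) - u - 1 = -u := by ring
    have h5 : (1 : ℂ) - (1 - u) = u := by ring
    rw [h1, h2, h3, h4, h5]
    ring
  · rw [hn] at hu
    simp at hu
    have := Nat.cast_nonneg (α := ℝ) n
    linarith

/-! ### Contour integrals by residues. -/

/-- The residue theorem for a disc and finitely many simple poles. -/
theorem circleIntegral_eq_sum_residues {c : ℂ} {R : ℝ} (hR : 0 < R) (P : Finset ℂ)
    (hP : ∀ p ∈ P, p ∈ Metric.ball c R) (res f : ℂ → ℂ)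
    (hf : ∀ z ∈ Metric.closedBall c R, z ∉ P → AnalyticAt ℂ f z)
    (hres : ∀ p ∈ P, Tendsto (fun z => (z - p) * f z) (𝓝[≠] p) (𝓝 (res p))) :
    ∮ z in C(c, R), f z = 2 * Real.pi * Complex.I * ∑ p ∈ P, res p := by
  classical
  induction P using Finset.induction_on generalizing f with
  | empty =>
    rw [Finset.sum_empty, mul_zero]
    refine circleIntegral_eq_zero_of_differentiable_on_off_countable hR.le Set.countable_empty ?_ ?_
    · exact fun z hz => (hf z hz (by simp)).continuousAt.continuousWithinAt
    · exact fun z hz => (hf z (Metric.ball_subset_closedBall hz.1) (by simp)).differentiableAt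
  | insert p P hp ih =>
    have hpb := hP p (Finset.mem_insert_self _ _)
    have hpres := hres p (Finset.mem_insert_self _ _)
    have hopen : IsOpen (Metric.ball c R \ (P : Set ℂ)) :=
      Metric.isOpen_ball.sdiff P.finite_toSet.isClosed
    have hpm : p ∈ Metric.ball c R \ (P : Set ℂ) := ⟨hpb, by simpa using hp⟩
    -- Filling in the residue removes the singularity of `(z - p) f(z)` at `p`. The slope of `g` at
    -- `p` is then `f` minus its polar part, again analytic at `p`, and the induction continues with
    -- one pole fewer.
    set g : ℂ → ℂ := Function.update (fun z => (z - p) * f z) p (res p) with hg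
    have hg_ne : ∀ z, z ≠ p → g =ᶠ[𝓝 z] fun z => (z - p) * f z := by
      intro z hz
      filter_upwards [isOpen_ne.mem_nhds hz] with y hy
      rw [hg, Function.update_of_ne hy]
    have hgp : AnalyticAt ℂ g p := by
      refine analyticAt_of_differentiable_on_punctured_nhds_of_continuousAt ?_ ?_
      · filter_upwards [self_mem_nhdsWithin, mem_nhdsWithin_of_mem_nhds (hopen.mem_nhds hpm)]
          with z hz hz'
        have h1 : AnalyticAt ℂ (fun z => (z - p) * f z) z :=
          AnalyticAt.fun_mul (by fun_prop) (hf z (Metric.ball_subset_closedBall hz'.1) (by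
            rw [Finset.mem_insert]
            rintro (h | h)
            exacts [hz h, hz'.2 (by simpa using h)]))
        exact (h1.congr (hg_ne z hz).symm).differentiableAt
      · rw [hg]
        exact continuousAt_update_same.mpr hpres
    set h : ℂ → ℂ := dslope g p with hh
    have hfh : ∀ z, z ≠ p → f z = h z + res p * (z - p)⁻¹ := by
      intro z hz
      have hz' : z - p ≠ 0 := sub_ne_zero.mpr hz
      rw [hh, dslope_of_ne _ hz, slope_def_field, hg, Function.update_of_ne hz,
        Function.update_self]
      field_simp
      ring
    have hhf : ∀ z, z ≠ p → h z = f z - res p * (z - p)⁻¹ := fun z hz => by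
      rw [hfh z hz]; ring
    have hinv : ∀ z, z ≠ p → AnalyticAt ℂ (fun z => res p * (z - p)⁻¹) z := fun z hz =>
      analyticAt_const.fun_mul (AnalyticAt.fun_inv (by fun_prop) (sub_ne_zero.mpr hz))
    have hhana : ∀ z ∈ Metric.closedBall c R, z ∉ P → AnalyticAt ℂ h z := by
      intro z hz hzP
      by_cases hzp : z = p
      · rw [hzp]
        obtain ⟨s, hs⟩ := hgp
        exact ⟨_, hs.has_fpower_series_dslope_fslope⟩
      · refine AnalyticAt.congr ((hf z hz (by simp [hzp, hzP])).fun_sub (hinv z hzp)) ?_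
        filter_upwards [isOpen_ne.mem_nhds hzp] with y hy using (hhf y hy).symm
    have hhres : ∀ p' ∈ P, Tendsto (fun z => (z - p') * h z) (𝓝[≠] p') (𝓝 (res p')) := by
      intro p' hp'
      have hne : p' ≠ p := fun h => hp (h ▸ hp')
      have h1 := hres p' (Finset.mem_insert_of_mem hp')
      have h2 : Tendsto (fun z => (z - p') * (res p * (z - p)⁻¹)) (𝓝[≠] p') (𝓝 0) := by
        have : ContinuousAt (fun z => (z - p') * (res p * (z - p)⁻¹)) p' :=
          ContinuousAt.mul (by fun_prop) (hinv p' hne).continuousAt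
        have := this.tendsto
        simp only [sub_self, zero_mul] at this
        exact this.mono_left nhdsWithin_le_nhds
      have h3 := h1.sub h2
      rw [sub_zero] at h3
      refine h3.congr' ?_
      filter_upwards [mem_nhdsWithin_of_mem_nhds (isOpen_ne.mem_nhds hne)] with z hz
      rw [hhf z hz]
      ring
    have hsph : ∀ z ∈ Metric.sphere c R, z ≠ p ∧ z ∉ P := by
      intro z hz
      have hz' : z ∉ Metric.ball c R := by
        rw [Metric.mem_ball, not_lt]; exact (Metric.mem_sphere.mp hz).ge
      exact ⟨fun h => hz' (h ▸ hpb), fun h => hz' (hP z (Finset.mem_insert_of_mem h))⟩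
    have hi1 : CircleIntegrable h c R := ContinuousOn.circleIntegrable hR.le fun z hz =>
      (hhana z (Metric.sphere_subset_closedBall hz) (hsph z hz).2).continuousAt.continuousWithinAt
    have hi2 : CircleIntegrable (fun z => res p * (z - p)⁻¹) c R :=
      ContinuousOn.circleIntegrable hR.le fun z hz =>
        (hinv z (hsph z hz).1).continuousAt.continuousWithinAt
    rw [circleIntegral.integral_congr hR.le fun z hz => hfh z (hsph z hz).1,
      circleIntegral.integral_add hi1 hi2,
      ih (fun p' hp' => hP p' (Finset.mem_insert_of_mem hp')) h hhana hhres,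
      circleIntegral.integral_const_mul, circleIntegral.integral_sub_inv_of_mem_ball hpb,
      Finset.sum_insert hp]
    ring

/-- A double contour integral whose kernel depends on the sum of the variables. -/
theorem double_circleIntegral_eq_sum_residues {c : ℂ} {R : ℝ} (hR : 0 < R) (P Q : Finset ℂ)
    (hP : ∀ p ∈ P, p ∈ Metric.ball c R) (hQ : ∀ p ∈ Q, p ∈ Metric.ball c R)
    (resF resG F G k : ℂ → ℂ)
    (hk : ∀ w ∈ Metric.closedBall c R, ∀ z ∈ Metric.closedBall c R, AnalyticAt ℂ k (w + z))
    (hF : ∀ z ∈ Metric.closedBall c R, z ∉ P → AnalyticAt ℂ F z)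
    (hG : ∀ z ∈ Metric.closedBall c R, z ∉ Q → AnalyticAt ℂ G z)
    (hresF : ∀ p ∈ P, Tendsto (fun z => (z - p) * F z) (𝓝[≠] p) (𝓝 (resF p)))
    (hresG : ∀ p ∈ Q, Tendsto (fun z => (z - p) * G z) (𝓝[≠] p) (𝓝 (resG p))) :
    ∮ w in C(c, R), ∮ z in C(c, R), k (w + z) * F w * G z =
      (2 * Real.pi * Complex.I) ^ 2 * ∑ p ∈ P, ∑ p' ∈ Q, k (p + p') * resF p * resG p' := by
  have hkz : ∀ w ∈ Metric.closedBall c R, ∀ z ∈ Metric.closedBall c R,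
      AnalyticAt ℂ (fun z => k (w + z)) z := fun w hw z hz =>
    AnalyticAt.fun_comp (f := fun z => w + z) (hk w hw z hz) (by fun_prop)
  have hkw : ∀ z ∈ Metric.closedBall c R, ∀ w ∈ Metric.closedBall c R,
      AnalyticAt ℂ (fun w => k (w + z)) w := fun z hz w hw =>
    AnalyticAt.fun_comp (f := fun w => w + z) (hk w hw z hz) (by fun_prop)
  have hb := Metric.ball_subset_closedBall (x := c) (ε := R)
  have hinner : ∀ w ∈ Metric.sphere c R, ∮ z in C(c, R), k (w + z) * F w * G z =
      2 * Real.pi * Complex.I * ∑ p' ∈ Q, k (w + p') * F w * resG p' := by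
    intro w hw
    have hw' := Metric.sphere_subset_closedBall hw
    refine circleIntegral_eq_sum_residues hR Q hQ (fun p' => k (w + p') * F w * resG p') _
      (fun z hz hzQ => ((hkz w hw' z hz).fun_mul analyticAt_const).fun_mul (hG z hz hzQ))
      fun p' hp' => ?_
    have h1 : Tendsto (fun z => k (w + z) * F w) (𝓝[≠] p') (𝓝 (k (w + p') * F w)) :=
      ((hkz w hw' p' (hb (hQ p' hp'))).fun_mul analyticAt_const).continuousAt.tendsto.mono_left
        nhdsWithin_le_nhds
    exact (h1.mul (hresG p' hp')).congr fun z => by ring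
  rw [circleIntegral.integral_congr hR.le hinner, circleIntegral.integral_const_mul,
    circleIntegral_eq_sum_residues hR P hP
      (fun p => ∑ p' ∈ Q, k (p + p') * resF p * resG p') _
      (fun w hw hwP => Finset.analyticAt_fun_sum _ fun p' hp' =>
        ((hkw p' (hb (hQ p' hp')) w hw).fun_mul (hF w hw hwP)).fun_mul analyticAt_const)]
  · ring
  · intro p hp
    have h1 : Tendsto (fun w => ∑ p' ∈ Q, k (w + p') * ((w - p) * F w) * resG p') (𝓝[≠] p)
        (𝓝 (∑ p' ∈ Q, k (p + p') * resF p * resG p')) :=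
      tendsto_finsetSum _ fun p' hp' =>
        (((hkw p' (hb (hQ p' hp')) p (hb (hP p hp))).continuousAt.tendsto.mono_left
          nhdsWithin_le_nhds).mul (hresF p hp)).mul_const _
    refine h1.congr fun w => ?_
    rw [Finset.mul_sum]
    exact Finset.sum_congr rfl fun p' _ => by ring

/-- Circle integrals do not see a single point. -/
theorem circleIntegral_congr_of_ne {c : ℂ} {R : ℝ} (hR : R ≠ 0) {f g : ℂ → ℂ} (x : ℂ)
    (h : ∀ z ∈ Metric.sphere c |R|, z ≠ x → f z = g z) :
    ∮ z in C(c, R), f z = ∮ z in C(c, R), g z := by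
  refine intervalIntegral.integral_congr_ae ?_
  have h0 := ((Set.countable_singleton x).preimage_circleMap c hR).ae_notMem MeasureTheory.volume
  filter_upwards [h0] with θ hθ _
  rw [h _ (circleMap_mem_sphere' c R θ) fun h' => hθ (by simp [h'])]

/-! ### Residues of the twisted series and the evaluation of one `q`-term. -/

section Twists

variable {A C : Finset ℂ}

theorem GRH.continuedLSeries_twist (hGRH : GRH) (hC : ∀ γ ∈ C, 0 < γ.re) (q : ℕ) [NeZero q]
    {w : ℂ} (hw : 1 / 2 < w.re) (hwA : 1 - w ∉ A) :
    ContinuesTo (twist A C q) w ∧ AnalyticAt ℂ (continuedLSeries (twist A C q)) w := by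
  obtain ⟨F, hF⟩ := hGRH.twistsContinue_I (q := q) A C hC fun x => ZMod.stdAddChar x
  rw [twist_eq]
  refine ⟨hF.continuesTo hw hwA, (hF.analyticAt w hw hwA).congr ?_⟩
  have ho : IsOpen {w : ℂ | 1 / 2 < w.re} := isOpen_lt continuous_const continuous_re
  have hc : IsClosed {w : ℂ | 1 - w ∈ A} :=
    A.finite_toSet.isClosed.preimage (f := fun w : ℂ => 1 - w) (by fun_prop)
  filter_upwards [ho.mem_nhds hw, hc.isOpen_compl.mem_nhds hwA] with z hz hzA
  exact (hF.continuedLSeries_eq hz hzA).symm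

/-- The residue at `1 - α` of the twisted series is a series over multiples of `q`. -/
theorem GRH.tendsto_twist_residue (hGRH : GRH) (hC : ∀ γ ∈ C, 0 < γ.re) (q : ℕ) [NeZero q]
    {α : ℂ} (hα : α ∈ A) (hα' : α.re < 1 / 2) :
    Tendsto (fun w => (w - (1 - α)) * continuedLSeries (twist A C q) w) (𝓝[≠] (1 - α))
      (𝓝 (continuedLSeries (fun n => if q ∣ n then I (A.erase α) C n else 0) (1 - α))) := by
  have hc : IsClosed {w : ℂ | 1 - w ∈ A.erase α} :=
    (A.erase α).finite_toSet.isClosed.preimage (f := fun w : ℂ => 1 - w) (by fun_prop)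
  have h := tendsto_sub_mul_continuedLSeries (q := q) (α := α) hc
    (by rw [sub_re, one_re]; linarith) (by simp)
    (hGRH.twistsContinue_I (A.erase α) C hC) fun x => ZMod.stdAddChar x
  rw [← I_eq_powFun_mul hα, ← twist_eq] at h
  have hq : (q : ℂ) ≠ 0 := by exact_mod_cast NeZero.ne q
  have heq : (fun n => if q ∣ n then I (A.erase α) C n else 0) = fun n : ℕ =>
      I (A.erase α) C n * ((∑ r : ZMod q, (ZMod.stdAddChar (r * (n : ZMod q)) : ℂ)) / q) := by
    ext n
    rw [sum_stdAddChar_mul]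
    split_ifs
    · rw [div_self hq, mul_one]
    · simp
  rw [heq]
  exact h

end Twists

/-- The `q`-th term of the correlation, evaluated by residues. -/
theorem GRH.correlationTerm_eq (hGRH : GRH) {A B C D : Finset ℂ} (hC : ∀ γ ∈ C, 0 < γ.re)
    (hD : ∀ γ ∈ D, 0 < γ.re) {ε : ℝ} (hε0 : 0 < ε) (hε : ε < 1 / 2)
    (hA : ∀ α ∈ A, ‖α‖ < ε) (hB : ∀ β ∈ B, ‖β‖ < ε) {s : ℂ} (hs : 2 * ε < s.re)
    {q : ℕ} (hq : q ≠ 0) :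
    correlationTerm A B C D ε s q = ∑ α ∈ A, ∑ β ∈ B,
      riemannZeta (1 - α - β - s) * jordanSum q (1 - α - β - s) *
        continuedLSeries (fun n => if q ∣ n then I (A.erase α) C n else 0) (1 - α) *
        continuedLSeries (fun n => if q ∣ n then I (B.erase β) D n else 0) (1 - β) := by
  classical
  have : NeZero q := ⟨hq⟩
  have hre : ∀ w ∈ Metric.closedBall (1 : ℂ) ε, 1 - ε ≤ w.re ∧ w.re ≤ 1 + ε := by
    intro w hw
    rw [mem_closedBall_iff_norm] at hw
    have h := (abs_re_le_norm (w - 1)).trans hw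
    rw [sub_re, one_re, abs_le] at h
    constructor <;> linarith [h.1, h.2]
  set k : ℂ → ℂ := fun y => riemannZeta (y - s - 1) * jordanSum q (y - s - 1) with hkdef
  have hk : ∀ w ∈ Metric.closedBall (1 : ℂ) ε, ∀ z ∈ Metric.closedBall (1 : ℂ) ε,
      AnalyticAt ℂ k (w + z) := by
    intro w hw z hz
    -- On the closed discs `Re (w + z - s - 1) ≤ 1 + 2ε - Re s < 1`, so the zeta factor of the
    -- kernel has no pole.
    have h1 : w + z - s - 1 ≠ 1 := by
      intro h
      have := congrArg re h
      simp only [sub_re, add_re, one_re] at this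
      linarith [(hre w hw).2, (hre z hz).2]
    exact (AnalyticAt.fun_comp (f := fun y : ℂ => y - s - 1) (riemannZeta_analyticAt h1)
      (by fun_prop)).fun_mul (AnalyticAt.fun_comp (f := fun y : ℂ => y - s - 1)
        (jordanSum_analyticAt q _) (by fun_prop))
  have hmem : ∀ {A' : Finset ℂ}, (∀ α ∈ A', ‖α‖ < ε) →
      ∀ p ∈ A'.image (fun α => 1 - α), p ∈ Metric.ball (1 : ℂ) ε := by
    intro A' hA' p hp
    obtain ⟨α, hα, rfl⟩ := Finset.mem_image.mp hp
    rw [mem_ball_iff_norm]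
    simpa using hA' α hα
  have himg : ∀ {A' : Finset ℂ} {z : ℂ}, z ∉ A'.image (fun α => 1 - α) → 1 - z ∉ A' := by
    intro A' z hz h
    exact hz (Finset.mem_image.mpr ⟨1 - z, h, by ring⟩)
  have hαre : ∀ {A' : Finset ℂ}, (∀ α ∈ A', ‖α‖ < ε) → ∀ α ∈ A', α.re < 1 / 2 := by
    intro A' hA' α hα
    linarith [(le_abs_self _).trans (abs_re_le_norm α), hA' α hα]
  have hana : ∀ {A' C' : Finset ℂ}, (∀ γ ∈ C', 0 < γ.re) → ∀ z ∈ Metric.closedBall (1 : ℂ) ε,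
      z ∉ A'.image (fun α => 1 - α) → AnalyticAt ℂ (continuedLSeries (twist A' C' q)) z :=
    fun hC' z hz hz' => (hGRH.continuedLSeries_twist hC' q
      (by linarith [(hre z hz).1]) (himg hz')).2
  have hres : ∀ {A' C' : Finset ℂ}, (∀ γ ∈ C', 0 < γ.re) → (∀ α ∈ A', ‖α‖ < ε) →
      ∀ p ∈ A'.image (fun α => 1 - α),
        Tendsto (fun z => (z - p) * continuedLSeries (twist A' C' q) z) (𝓝[≠] p)
          (𝓝 (continuedLSeries (fun n => if q ∣ n then I (A'.erase (1 - p)) C' n else 0) p)) := by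
    intro A' C' hC' hA' p hp
    obtain ⟨α, hα, rfl⟩ := Finset.mem_image.mp hp
    rw [sub_sub_cancel]
    exact hGRH.tendsto_twist_residue hC' q hα (hαre hA' α hα)
  have hmain := double_circleIntegral_eq_sum_residues hε0 _ _ (hmem hA) (hmem hB) _ _
    (continuedLSeries (twist A C q)) (continuedLSeries (twist B D q)) k hk (hana hC) (hana hD)
    (hres hC hA) (hres hD hB)
  have hint : ∀ w ∈ Metric.sphere (1 : ℂ) ε,
      (∮ z in C(1, ε), chi (w + z - s - 1) * continuedLSeries (ramanujanSum q) (s + 2 - w - z) *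
        continuedLSeries (twist A C q) w * continuedLSeries (twist B D q) z) =
      ∮ z in C(1, ε), k (w + z) * continuedLSeries (twist A C q) w *
        continuedLSeries (twist B D q) z := by
    intro w hw
    -- At `z = s + 1 - w` the Ramanujan series may have its pole, where no continued value is
    -- guaranteed; this single point of the circle does not affect the integral. Elsewhere `Re (s +
    -- 2 - w - z) ≥ Re s - 2ε > 0`, as the functional equation requires.
    refine circleIntegral_congr_of_ne hε0.ne' (s + 1 - w) fun z hz hne => ?_
    rw [abs_of_pos hε0] at hz
    have hu1 : s + 2 - w - z ≠ 1 := by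
      intro h
      exact hne (by linear_combination -h)
    have hu0 : 0 < (s + 2 - w - z).re := by
      have h2 : (2 : ℂ).re = 2 := by norm_num
      simp only [sub_re, add_re, h2]
      linarith [(hre w (Metric.sphere_subset_closedBall hw)).2,
        (hre z (Metric.sphere_subset_closedBall hz)).2]
    have h1 := chi_one_sub_mul_riemannZeta hu0 hu1
    have h2 : 1 - (s + 2 - w - z) = w + z - s - 1 := by ring
    rw [h2] at h1
    rw [(hasContinuedValue_ramanujanSum hq hu1).continuedLSeries_eq, h2, ← mul_assoc, h1]
  have hpi : (2 * Real.pi * Complex.I : ℂ) ^ 2 ≠ 0 := pow_ne_zero 2 two_pi_I_ne_zero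
  rw [correlationTerm, circleIntegral.integral_congr hε0.le hint, hmain, ← mul_assoc,
    one_div_mul_cancel hpi, one_mul,
    Finset.sum_image fun x _ y _ h => sub_right_injective h]
  refine Finset.sum_congr rfl fun α _ => ?_
  rw [Finset.sum_image fun x _ y _ h => sub_right_injective h]
  refine Finset.sum_congr rfl fun β _ => ?_
  simp only [sub_sub_cancel, hkdef]
  have : 1 - α + (1 - β) - s - 1 = 1 - α - β - s := by ring
  rw [this]

/-! ### The Rankin-Selberg identity in its region of absolute convergence. -/

/-- Interchange of summation in a sum of products of two series. -/
theorem tsum_mul_tsum_mul_tsum_comm {W : ℕ → ℂ} {k₁ k₂ : ℕ → ℕ → ℂ} {c₁ c₂ : ℕ → ℝ} {K : ℝ}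
    (hc₁ : ∀ n, 0 ≤ c₁ n)
    (h₁ : ∀ n i, ‖k₁ n i‖ ≤ c₁ n * (i : ℝ) ^ (-2 : ℝ))
    (h₂ : ∀ n i, ‖k₂ n i‖ ≤ c₂ n * (i : ℝ) ^ (-2 : ℝ))
    (hW : ∀ n, ‖W n‖ * (c₁ n * c₂ n) ≤ K * (n : ℝ) ^ (-2 : ℝ)) :
    Summable (fun n => W n * ((∑' i, k₁ n i) * ∑' j, k₂ n j)) ∧
      ∑' n, W n * ((∑' i, k₁ n i) * ∑' j, k₂ n j) =
        ∑' x : ℕ × ℕ, ∑' n, W n * (k₁ n x.1 * k₂ n x.2) := by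
  have hs : Summable fun n : ℕ => (n : ℝ) ^ (-2 : ℝ) := Real.summable_nat_rpow.mpr (by norm_num)
  have hnn : (0 : ℕ → ℝ) ≤ fun n : ℕ => (n : ℝ) ^ (-2 : ℝ) := fun n => by
    simp only [Pi.zero_apply]; positivity
  have hs1 : ∀ n, Summable fun i => ‖k₁ n i‖ := fun n =>
    Summable.of_nonneg_of_le (fun _ => norm_nonneg _) (h₁ n) (hs.mul_left _)
  have hs2 : ∀ n, Summable fun i => ‖k₂ n i‖ := fun n =>
    Summable.of_nonneg_of_le (fun _ => norm_nonneg _) (h₂ n) (hs.mul_left _)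
  have hs3 : Summable fun t : ℕ × (ℕ × ℕ) =>
      (t.1 : ℝ) ^ (-2 : ℝ) * ((t.2.1 : ℝ) ^ (-2 : ℝ) * (t.2.2 : ℝ) ^ (-2 : ℝ)) :=
    hs.mul_of_nonneg (g := fun x : ℕ × ℕ => (x.1 : ℝ) ^ (-2 : ℝ) * (x.2 : ℝ) ^ (-2 : ℝ))
      (hs.mul_of_nonneg hs hnn hnn) hnn fun x => by simp only [Pi.zero_apply]; positivity
  have hsum : Summable fun t : ℕ × (ℕ × ℕ) => W t.1 * (k₁ t.1 t.2.1 * k₂ t.1 t.2.2) := by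
    refine Summable.of_norm_bounded (hs3.mul_left K) fun ⟨n, i, j⟩ => ?_
    dsimp only
    rw [norm_mul, norm_mul]
    calc ‖W n‖ * (‖k₁ n i‖ * ‖k₂ n j‖)
        ≤ ‖W n‖ * ((c₁ n * (i : ℝ) ^ (-2 : ℝ)) * (c₂ n * (j : ℝ) ^ (-2 : ℝ))) := by
          refine mul_le_mul_of_nonneg_left (mul_le_mul (h₁ n i) (h₂ n j) (norm_nonneg _) ?_)
            (norm_nonneg _)
          exact mul_nonneg (hc₁ n) (by positivity)
      _ = (‖W n‖ * (c₁ n * c₂ n)) * ((i : ℝ) ^ (-2 : ℝ) * (j : ℝ) ^ (-2 : ℝ)) := by ring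
      _ ≤ (K * (n : ℝ) ^ (-2 : ℝ)) * ((i : ℝ) ^ (-2 : ℝ) * (j : ℝ) ^ (-2 : ℝ)) :=
          mul_le_mul_of_nonneg_right (hW n) (by positivity)
      _ = _ := by ring
  have heq : ∀ n, W n * ((∑' i, k₁ n i) * ∑' j, k₂ n j) =
      ∑' x : ℕ × ℕ, W n * (k₁ n x.1 * k₂ n x.2) := fun n => by
    rw [tsum_mul_tsum_of_summable_norm (hs1 n) (hs2 n), tsum_mul_left]
  simp only [heq]
  refine ⟨hsum.prod, ?_⟩
  exact (Summable.tsum_comm (f := fun n (x : ℕ × ℕ) => W n * (k₁ n x.1 * k₂ n x.2)) hsum).symm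

theorem tsum_divisors_eq_mul {f : ArithmeticFunction ℂ} (b : ℂ) (n : ℕ) :
    ∑' i, (if i ∣ n then f i * powFun (-b) (n / i) else 0) = (powFun (-b) * f) n := by
  rcases eq_or_ne n 0 with rfl | hn
  · simp
  · rw [tsum_eq_sum (s := n.divisors) fun i hi => by
      rw [if_neg fun h => hi (Nat.mem_divisors.mpr ⟨h, hn⟩)], mul_comm (powFun (-b)),
      ArithmeticFunction.mul_apply,
      Nat.sum_divisorsAntidiagonal (f := fun i j => f i * powFun (-b) j)]
    exact Finset.sum_congr rfl fun i hi => if_pos (Nat.dvd_of_mem_divisors hi)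

theorem powFun_neg_div {n i : ℕ} (hn : n ≠ 0) (hi : i ∣ n) (b : ℂ) :
    powFun (-b) (n / i) = (n : ℂ) ^ b * (i : ℂ) ^ (-b) := by
  obtain ⟨k, rfl⟩ := hi
  have hi0 := left_ne_zero_of_mul hn
  have hk0 := right_ne_zero_of_mul hn
  have hi0' : (i : ℂ) ≠ 0 := by exact_mod_cast hi0
  rw [Nat.mul_div_cancel_left k (Nat.pos_of_ne_zero hi0), powFun_apply hk0, neg_neg, Nat.cast_mul,
    natCast_mul_natCast_cpow, cpow_neg]
  have : (i : ℂ) ^ b ≠ 0 := by rw [cpow_ne_zero_iff]; exact Or.inl hi0'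
  field_simp

/-- Only `i ≤ n` occurs, so the decay `i^{-2}` can be bought at the price of `n^2`, which a large
`Re u` pays for. The uniform shape `c(n) i^{-2}` is what the interchange lemma asks for. -/
theorem norm_divisor_term_le {f : ArithmeticFunction ℂ} {c K : ℝ} (hK : 0 ≤ K)
    (hf : ∀ n : ℕ, n ≠ 0 → ‖f n‖ ≤ c * (n : ℝ) ^ K) (hc : 0 ≤ c) (b : ℂ) (n i : ℕ) :
    ‖if i ∣ n then f i * powFun (-b) (n / i) else 0‖ ≤
      (c * (n : ℝ) ^ (K + |b.re| + 2)) * (i : ℝ) ^ (-2 : ℝ) := by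
  have hpos : 0 ≤ (c * (n : ℝ) ^ (K + |b.re| + 2)) * (i : ℝ) ^ (-2 : ℝ) := by positivity
  rcases eq_or_ne n 0 with rfl | hn
  · simpa using hpos
  split_ifs with hi
  · have hi0 : i ≠ 0 := ne_zero_of_dvd_ne_zero hn hi
    have hk : n / i ≠ 0 := (Nat.div_pos (Nat.le_of_dvd (Nat.pos_of_ne_zero hn) hi)
      (Nat.pos_of_ne_zero hi0)).ne'
    have hi1 : (1 : ℝ) ≤ i := by exact_mod_cast Nat.one_le_iff_ne_zero.mpr hi0
    have hin : (i : ℝ) ≤ n := by exact_mod_cast Nat.le_of_dvd (Nat.pos_of_ne_zero hn) hi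
    have hk1 : (1 : ℝ) ≤ (n / i : ℕ) := by exact_mod_cast Nat.one_le_iff_ne_zero.mpr hk
    have hkn : ((n / i : ℕ) : ℝ) ≤ n := by exact_mod_cast Nat.div_le_self n i
    have hn1 : (0 : ℝ) < n := by linarith
    have h1 : ‖powFun (-b) (n / i)‖ ≤ (n : ℝ) ^ |b.re| := by
      rw [powFun_apply hk, norm_natCast_cpow_neg hk, neg_re, neg_neg]
      exact (Real.rpow_le_rpow_of_exponent_le hk1 (le_abs_self _)).trans
        (Real.rpow_le_rpow (by linarith) hkn (abs_nonneg _))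
    have h2 : (i : ℝ) ^ K ≤ (n : ℝ) ^ (K + 2) * (i : ℝ) ^ (-2 : ℝ) := by
      calc (i : ℝ) ^ K = (i : ℝ) ^ (K + 2) * (i : ℝ) ^ (-2 : ℝ) := by
            rw [← Real.rpow_add (by linarith)]; congr 1; ring
        _ ≤ _ := by gcongr
    calc ‖f i * powFun (-b) (n / i)‖ ≤ (c * (i : ℝ) ^ K) * (n : ℝ) ^ |b.re| := by
          rw [norm_mul]
          exact mul_le_mul (hf i hi0) h1 (norm_nonneg _) (by positivity)
      _ ≤ (c * ((n : ℝ) ^ (K + 2) * (i : ℝ) ^ (-2 : ℝ))) * (n : ℝ) ^ |b.re| := by gcongr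
      _ = _ := by
          rw [show K + |b.re| + 2 = (K + 2) + |b.re| by ring, Real.rpow_add hn1 (K + 2)]
          ring
  · simpa using hpos

/-- Here `q ≤ i`, so the surplus decay in `i` is turned into decay in `q`. -/
theorem norm_multiple_term_le {f : ArithmeticFunction ℂ} {c K : ℝ}
    (hf : ∀ n : ℕ, n ≠ 0 → ‖f n‖ ≤ c * (n : ℝ) ^ K) (hc : 0 ≤ c) {w : ℂ} (hw : K + 2 ≤ w.re)
    (q i : ℕ) :
    ‖LSeries.term (fun n => if q ∣ n then f n else 0) w i‖ ≤
      (c * (q : ℝ) ^ (K + 2 - w.re)) * (i : ℝ) ^ (-2 : ℝ) := by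
  have hpos : 0 ≤ (c * (q : ℝ) ^ (K + 2 - w.re)) * (i : ℝ) ^ (-2 : ℝ) := by positivity
  rcases eq_or_ne i 0 with rfl | hi
  · simp
  rw [LSeries.norm_term_eq, if_neg hi]
  split_ifs with hq
  · have hq0 : q ≠ 0 := ne_zero_of_dvd_ne_zero hi hq
    have hq1 : (1 : ℝ) ≤ q := by exact_mod_cast Nat.one_le_iff_ne_zero.mpr hq0
    have hqi : (q : ℝ) ≤ i := by exact_mod_cast Nat.le_of_dvd (Nat.pos_of_ne_zero hi) hq
    have hi0 : (0 : ℝ) < i := by linarith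
    calc ‖f i‖ / (i : ℝ) ^ w.re ≤ (c * (i : ℝ) ^ K) / (i : ℝ) ^ w.re := by
          gcongr; exact hf i hi
      _ = c * (i : ℝ) ^ (K + 2 - w.re) * (i : ℝ) ^ (-2 : ℝ) := by
          rw [mul_assoc, ← Real.rpow_add hi0, mul_div_assoc, ← Real.rpow_sub hi0]
          congr 2; ring
      _ ≤ _ := by
          have h := Real.rpow_le_rpow_of_nonpos (z := K + 2 - w.re)
            (by linarith : (0 : ℝ) < q) hqi (by linarith)
          exact mul_le_mul_of_nonneg_right (mul_le_mul_of_nonneg_left h hc) (by positivity)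
  · simpa using hpos

theorem lcm_cpow_identity {i j : ℕ} (hi : i ≠ 0) (hj : j ≠ 0) (a b u : ℂ) :
    (i : ℂ) ^ (-b) * (j : ℂ) ^ (-a) * (i.lcm j : ℂ) ^ (-(u - a - b)) =
      (i : ℂ) ^ (-(u - a)) * (j : ℂ) ^ (-(u - b)) * (i.gcd j : ℂ) ^ (u - a - b) := by
  have hi' : (i : ℂ) ≠ 0 := by exact_mod_cast hi
  have hj' : (j : ℂ) ≠ 0 := by exact_mod_cast hj
  have hg : ((i.gcd j : ℕ) : ℂ) ≠ 0 := by exact_mod_cast (Nat.gcd_pos_of_pos_left _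
    (Nat.pos_of_ne_zero hi)).ne'
  have h : (i.gcd j : ℂ) ^ (-(u - a - b)) * (i.lcm j : ℂ) ^ (-(u - a - b)) =
      (i : ℂ) ^ (-(u - a - b)) * (j : ℂ) ^ (-(u - a - b)) := by
    rw [← natCast_mul_natCast_cpow, ← natCast_mul_natCast_cpow, ← Nat.cast_mul, ← Nat.cast_mul,
      Nat.gcd_mul_lcm]
  have h' : (i.lcm j : ℂ) ^ (-(u - a - b)) = (i.gcd j : ℂ) ^ (u - a - b) *
      ((i : ℂ) ^ (-(u - a - b)) * (j : ℂ) ^ (-(u - a - b))) := by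
    rw [← h, ← mul_assoc, ← cpow_add _ _ hg, add_neg_cancel, cpow_zero, one_mul]
  rw [h', show -(u - a) = -b + -(u - a - b) by ring, show -(u - b) = -a + -(u - a - b) by ring,
    cpow_add _ _ hi', cpow_add _ _ hj']
  ring

/-- The admissible `n` are the multiples of `lcm(i, j)`, and `gcd * lcm = i * j` converts the lcm
power into a gcd power. For `i = 0` or `j = 0` both sides vanish because arithmetic functions are
zero at `0`. -/
theorem tsum_common_multiples {f g : ArithmeticFunction ℂ} {a b u : ℂ}
    (hy : 1 < (u - a - b).re) (i j : ℕ) :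
    ∑' n, LSeries.term 1 u n * ((if i ∣ n then f i * powFun (-b) (n / i) else 0) *
        (if j ∣ n then g j * powFun (-a) (n / j) else 0)) =
      riemannZeta (u - a - b) * ((f i * (i : ℂ) ^ (-(u - a))) * (g j * (j : ℂ) ^ (-(u - b))) *
        (i.gcd j : ℂ) ^ (u - a - b)) := by
  rcases eq_or_ne i 0 with rfl | hi
  · simp
  rcases eq_or_ne j 0 with rfl | hj
  · simp
  have hl : i.lcm j ≠ 0 := Nat.lcm_ne_zero hi hj
  have h := (LSeriesHasSum_dvd hl hy).mul_left
    (f i * g j * ((i : ℂ) ^ (-b) * (j : ℂ) ^ (-a)))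
  have hval : f i * g j * ((i : ℂ) ^ (-b) * (j : ℂ) ^ (-a)) *
      ((i.lcm j : ℂ) ^ (-(u - a - b)) * riemannZeta (u - a - b)) =
      riemannZeta (u - a - b) * ((f i * (i : ℂ) ^ (-(u - a))) * (g j * (j : ℂ) ^ (-(u - b))) *
        (i.gcd j : ℂ) ^ (u - a - b)) := by
    linear_combination (f i * g j * riemannZeta (u - a - b)) * lcm_cpow_identity hi hj a b u
  rw [← hval, ← h.tsum_eq]
  refine tsum_congr fun n => ?_
  rcases eq_or_ne n 0 with rfl | hn
  · simp
  have hn' : (n : ℂ) ≠ 0 := by exact_mod_cast hn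
  rw [LSeries.term_of_ne_zero hn, LSeries.term_of_ne_zero hn]
  by_cases hin : i ∣ n
  · by_cases hjn : j ∣ n
    · rw [if_pos hin, if_pos hjn, if_pos (Nat.lcm_dvd hin hjn), powFun_neg_div hn hin,
        powFun_neg_div hn hjn, one_div, ← cpow_neg, Pi.one_apply, one_div, ← cpow_neg,
        show -(u - a - b) = -u + b + a by ring, cpow_add _ _ hn', cpow_add _ _ hn']
      ring
    · rw [if_neg hjn, if_neg fun h => hjn ((Nat.dvd_lcm_right i j).trans h)]
      simp
  · rw [if_neg hin, if_neg fun h => hin ((Nat.dvd_lcm_left i j).trans h)]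
    simp

/-- Only `q ∣ gcd(i, j)` survives, and Möbius inversion sums `J_q(y)` over these to `gcd(i, j)^y`.
This matches the value obtained from common multiples. -/
theorem tsum_common_divisors {f g : ArithmeticFunction ℂ} (w z y : ℂ) (i j : ℕ) :
    ∑' q, jordanSum q y * (LSeries.term (fun n => if q ∣ n then f n else 0) w i *
        LSeries.term (fun n => if q ∣ n then g n else 0) z j) =
      (f i * (i : ℂ) ^ (-w)) * (g j * (j : ℂ) ^ (-z)) * (i.gcd j : ℂ) ^ y := by
  rcases eq_or_ne i 0 with rfl | hi
  · simp
  rcases eq_or_ne j 0 with rfl | hj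
  · simp
  have hg : i.gcd j ≠ 0 := (Nat.gcd_pos_of_pos_left _ (Nat.pos_of_ne_zero hi)).ne'
  rw [tsum_eq_sum (s := (i.gcd j).divisors), ← sum_divisors_jordanSum hg, Finset.mul_sum]
  · refine Finset.sum_congr rfl fun q hq => ?_
    have hqg := Nat.dvd_of_mem_divisors hq
    rw [LSeries.term_of_ne_zero hi, LSeries.term_of_ne_zero hj,
      if_pos (hqg.trans (Nat.gcd_dvd_left i j)), if_pos (hqg.trans (Nat.gcd_dvd_right i j)),
      cpow_neg, cpow_neg]
    ring
  · intro q hq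
    rw [LSeries.term_of_ne_zero hi, LSeries.term_of_ne_zero hj]
    by_cases hqi : q ∣ i
    · have hqj : ¬ q ∣ j := fun hqj => hq (Nat.mem_divisors.mpr ⟨Nat.dvd_gcd hqi hqj, hg⟩)
      simp [hqj]
    · simp [hqi]

/-- The Rankin-Selberg convolution in its region of absolute convergence. -/
theorem LSeries_rankin_eq {f g : ArithmeticFunction ℂ} {c₁ c₂ K : ℝ} (hK : 0 ≤ K)
    (hc₁ : 0 ≤ c₁) (hc₂ : 0 ≤ c₂) (hf : ∀ n : ℕ, n ≠ 0 → ‖f n‖ ≤ c₁ * (n : ℝ) ^ K)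
    (hg : ∀ n : ℕ, n ≠ 0 → ‖g n‖ ≤ c₂ * (n : ℝ) ^ K) {a b u : ℂ}
    (hu : 2 * K + 7 + |a.re| + |b.re| < u.re) :
    LSeriesSummable (fun n => (powFun (-b) * f) n * (powFun (-a) * g) n) u ∧
      LSeries (fun n => (powFun (-b) * f) n * (powFun (-a) * g) n) u =
        riemannZeta (u - a - b) * ∑' q, jordanSum q (u - a - b) *
          (LSeries (fun n => if q ∣ n then f n else 0) (u - a) *
            LSeries (fun n => if q ∣ n then g n else 0) (u - b)) := by
  have ha := le_abs_self a.re
  have hb := le_abs_self b.re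
  have ha' := abs_nonneg a.re
  have hb' := abs_nonneg b.re
  have hy : 1 < (u - a - b).re := by simp only [sub_re]; linarith
  -- First interchange: the outer variable is `n`, the inner ones are the divisors `i`, `j` of `n`
  -- in the two convolutions.
  have h1 := tsum_mul_tsum_mul_tsum_comm (W := LSeries.term 1 u) (K := c₁ * c₂)
    (c₁ := fun n => c₁ * (n : ℝ) ^ (K + |b.re| + 2))
    (c₂ := fun n => c₂ * (n : ℝ) ^ (K + |a.re| + 2)) (fun n => by positivity)
    (norm_divisor_term_le hK hf hc₁ b) (norm_divisor_term_le hK hg hc₂ a) fun n => by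
      rcases eq_or_ne n 0 with rfl | hn
      · simp
      have hn1 : (1 : ℝ) ≤ n := by exact_mod_cast Nat.one_le_iff_ne_zero.mpr hn
      have hn0 : (0 : ℝ) < n := by linarith
      rw [LSeries.norm_term_eq, if_neg hn, Pi.one_apply, norm_one, one_div,
        ← Real.rpow_neg hn0.le]
      calc (n : ℝ) ^ (-u.re) * (c₁ * (n : ℝ) ^ (K + |b.re| + 2) *
            (c₂ * (n : ℝ) ^ (K + |a.re| + 2)))
          = c₁ * c₂ * (n : ℝ) ^ (-u.re + ((K + |b.re| + 2) + (K + |a.re| + 2))) := by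
            rw [Real.rpow_add hn0 (-u.re), Real.rpow_add hn0 (K + |b.re| + 2)]; ring
        _ ≤ _ := by
            refine mul_le_mul_of_nonneg_left ?_ (by positivity)
            exact Real.rpow_le_rpow_of_exponent_le hn1 (by linarith)
  -- Second interchange: the outer variable is `q`. The crude bound `τ(q) ≤ q` leaves `q^{2K + 5 -
  -- Re u}`, which must be at most `q^{-2}`; this is where the constant `7` comes from.
  have h2 := tsum_mul_tsum_mul_tsum_comm (W := fun q => jordanSum q (u - a - b))
    (K := 2 * c₁ * c₂)
    (c₁ := fun q => c₁ * (q : ℝ) ^ (K + 2 - (u - a).re))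
    (c₂ := fun q => c₂ * (q : ℝ) ^ (K + 2 - (u - b).re)) (fun n => by positivity)
    (norm_multiple_term_le hf hc₁ (w := u - a) (by simp only [sub_re]; linarith))
    (norm_multiple_term_le hg hc₂ (w := u - b) (by simp only [sub_re]; linarith)) fun q => by
      rcases eq_or_ne q 0 with rfl | hq
      · simp [jordanSum]
      have hq1 : (1 : ℝ) ≤ q := by exact_mod_cast Nat.one_le_iff_ne_zero.mpr hq
      have hq0 : (0 : ℝ) < q := by linarith
      have hJ : ‖jordanSum q (u - a - b)‖ ≤ 2 * (q : ℝ) ^ (1 + (u - a - b).re) := by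
        refine (norm_jordanSum_le hq _).trans ?_
        have hd : (q.divisors.card : ℝ) ≤ q := by exact_mod_cast Nat.card_divisors_le_self q
        have h1 : (1 : ℝ) ≤ (q : ℝ) ^ (u - a - b).re :=
          Real.one_le_rpow hq1 (by linarith)
        calc (q.divisors.card : ℝ) * (1 + (q : ℝ) ^ (u - a - b).re)
            ≤ q * (2 * (q : ℝ) ^ (u - a - b).re) :=
              mul_le_mul hd (by linarith) (by positivity) hq0.le
          _ = _ := by rw [Real.rpow_add hq0, Real.rpow_one]; ring
      calc ‖jordanSum q (u - a - b)‖ * (c₁ * (q : ℝ) ^ (K + 2 - (u - a).re) *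
            (c₂ * (q : ℝ) ^ (K + 2 - (u - b).re)))
          ≤ (2 * (q : ℝ) ^ (1 + (u - a - b).re)) * (c₁ * (q : ℝ) ^ (K + 2 - (u - a).re) *
            (c₂ * (q : ℝ) ^ (K + 2 - (u - b).re))) :=
            mul_le_mul_of_nonneg_right hJ (by positivity)
        _ = 2 * c₁ * c₂ * (q : ℝ) ^ ((1 + (u - a - b).re) +
              ((K + 2 - (u - a).re) + (K + 2 - (u - b).re))) := by
            rw [Real.rpow_add hq0 (1 + (u - a - b).re), Real.rpow_add hq0 (K + 2 - (u - a).re)]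
            ring
        _ ≤ _ := by
            refine mul_le_mul_of_nonneg_left ?_ (by positivity)
            refine Real.rpow_le_rpow_of_exponent_le hq1 ?_
            simp only [sub_re]
            linarith
  have hterm : (fun n => LSeries.term 1 u n *
      ((∑' i, if i ∣ n then f i * powFun (-b) (n / i) else 0) *
        ∑' j, if j ∣ n then g j * powFun (-a) (n / j) else 0)) =
      LSeries.term (fun n => (powFun (-b) * f) n * (powFun (-a) * g) n) u := by
    ext n
    rw [tsum_divisors_eq_mul, tsum_divisors_eq_mul]
    rcases eq_or_ne n 0 with rfl | hn
    · simp
    rw [LSeries.term_of_ne_zero hn, LSeries.term_of_ne_zero hn, Pi.one_apply]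
    ring
  rw [hterm] at h1
  refine ⟨h1.1, ?_⟩
  rw [LSeries, h1.2]
  have h3 := h2.2
  simp only [tsum_common_divisors] at h3
  simp only [tsum_common_multiples hy]
  rw [tsum_mul_left, ← h3]
  rfl

/-! ### Continuation of the Rankin-Selberg series beyond absolute convergence. -/

theorem IsContinuation.LSeries_eq {a : ℕ → ℂ} {F : ℂ → ℂ} {P : Set ℂ} (h : IsContinuation a F P)
    {w₀ w : ℂ} (hw₀ : LSeriesSummable a w₀) (hw : w₀.re < w.re) (hw' : 1 / 2 < w.re)
    (hwP : w ∉ P) : LSeries a w = F w := by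
  have hab : ∀ z : ℂ, w₀.re < z.re → AnalyticAt ℂ (LSeries a) z := fun z hz =>
    LSeries_analyticOnNhd a z
      (lt_of_le_of_lt hw₀.abscissaOfAbsConv_le (EReal.coe_lt_coe_iff.mpr hz))
  have h1 : HasContinuedValue a w (LSeries a w) :=
    ⟨LSeries a, w₀.re, w₀.re, hw, fun z hz => (hab z hz).meromorphicAt,
      fun z hz => ⟨hw₀.of_re_le_re hz.le, rfl⟩, hab w hw, rfl⟩
  exact h1.unique (h.hasContinuedValue hw' hwP)

/-- Taking `q = 1` gives the whole series, and its convergence at one point bounds the coefficients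
polynomially. Any larger exponent also works, so that two functions can share one. -/
theorem HasDvdFactor.exists_norm_le {f : ArithmeticFunction ℂ} {Z : ℂ → ℂ} {m : ℝ} {P : Set ℂ}
    (h : HasDvdFactor f Z m P) :
    ∃ c K₀ : ℝ, 0 ≤ c ∧ 0 ≤ K₀ ∧ ∀ K, K₀ ≤ K → ∀ n : ℕ, n ≠ 0 → ‖f n‖ ≤ c * (n : ℝ) ^ K := by
  obtain ⟨ρ, M, hρ⟩ := h
  obtain ⟨τ, hτ⟩ := (hρ 1 one_ne_zero).2.2.exists_eq
  have hre : (((|τ| + 1 : ℝ) : ℂ)).re = |τ| + 1 := ofReal_re _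
  obtain ⟨c, hc⟩ := (hτ ((|τ| + 1 : ℝ) : ℂ)
    (by rw [hre]; linarith [le_abs_self τ])).1.le_const_mul_rpow
  refine ⟨|c|, |τ| + 1, abs_nonneg c, by positivity, fun K hK n hn => ?_⟩
  have h1 := hc n hn
  rw [if_pos (one_dvd n), hre] at h1
  have hn1 : (1 : ℝ) ≤ n := by exact_mod_cast Nat.one_le_iff_ne_zero.mpr hn
  calc ‖f n‖ ≤ c * (n : ℝ) ^ (|τ| + 1) := h1
    _ ≤ |c| * (n : ℝ) ^ (|τ| + 1) := by gcongr; exact le_abs_self c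
    _ ≤ _ := by gcongr

theorem LSeriesSummable_multiples {f : ArithmeticFunction ℂ} {c K : ℝ} (hc : 0 ≤ c)
    (hf : ∀ n : ℕ, n ≠ 0 → ‖f n‖ ≤ c * (n : ℝ) ^ K) (q : ℕ) {w : ℂ} (hw : K + 1 < w.re) :
    LSeriesSummable (fun n => if q ∣ n then f n else 0) w := by
  refine LSeriesSummable_of_le_const_mul_rpow hw ⟨c, fun n hn => ?_⟩
  rw [add_sub_cancel_right]
  split_ifs
  · exact hf n hn
  · rw [norm_zero]; positivity

/-- Continuation of the Rankin-Selberg convolution of `n^b * f` and `n^a * g`. -/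
theorem hasContinuedValue_rankin {f g : ArithmeticFunction ℂ} {Zf Zg : ℂ → ℂ} {m m' : ℝ}
    {P Q : Set ℂ} (hf : HasDvdFactor f Zf m P) (hg : HasDvdFactor g Zg m' Q)
    (hZf : ∀ w : ℂ, 1 / 2 < w.re → MeromorphicAt Zf w)
    (hZf' : ∀ w : ℂ, 1 / 2 < w.re → w ∉ P → AnalyticAt ℂ Zf w)
    (hZg : ∀ w : ℂ, 1 / 2 < w.re → MeromorphicAt Zg w)
    (hZg' : ∀ w : ℂ, 1 / 2 < w.re → w ∉ Q → AnalyticAt ℂ Zg w)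
    (hP : ∀ w ∈ P, w.re ≤ 2) (hQ : ∀ w ∈ Q, w.re ≤ 2) {a b : ℂ} {σ : ℝ}
    (ha : 1 / 2 ≤ σ - a.re) (hb : 1 / 2 ≤ σ - b.re)
    (hE₁ : 1 < 2 * σ - a.re - b.re + m + m') (hE₂ : 1 < σ + m + m') {u : ℂ} (hu : σ < u.re)
    (huP : u - a ∉ P) (huQ : u - b ∉ Q) (hu1 : u - a - b ≠ 1) :
    Summable (fun q : ℕ => jordanSum q (u - a - b) *
        (continuedLSeries (fun n => if q ∣ n then f n else 0) (u - a) *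
          continuedLSeries (fun n => if q ∣ n then g n else 0) (u - b))) ∧
      HasContinuedValue (fun n => (powFun (-b) * f) n * (powFun (-a) * g) n) u
        (riemannZeta (u - a - b) * ∑' q : ℕ, jordanSum q (u - a - b) *
          (continuedLSeries (fun n => if q ∣ n then f n else 0) (u - a) *
            continuedLSeries (fun n => if q ∣ n then g n else 0) (u - b))) := by
  obtain ⟨c₁, K₁, hc₁, hK₁, hf1⟩ := hf.exists_norm_le
  obtain ⟨c₂, K₂, hc₂, hK₂, hg1⟩ := hg.exists_norm_le
  obtain ⟨ρ, M, hρ⟩ := hf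
  obtain ⟨ρ', M', hρ'⟩ := hg
  have hare : ∀ v : ℂ, σ < v.re → 1 / 2 < (v - a).re := fun v hv => by rw [sub_re]; linarith
  have hbre : ∀ v : ℂ, σ < v.re → 1 / 2 < (v - b).re := fun v hv => by rw [sub_re]; linarith
  set T : ℕ → ℂ → ℂ := fun q v => jordanSum q (v - a - b) * (ρ q (v - a) * ρ' q (v - b)) with hT
  have hJ0 : ∀ x, jordanSum 0 x = 0 := fun x => by simp [jordanSum]
  set E₁ := 2 * σ - a.re - b.re + m + m' with hE₁def
  set E₂ := σ + m + m' with hE₂def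
  -- The two majorants come from the two summands of the bound `1 + q^{Re (v - a - b)}` for `J_q`.
  -- Both are largest at the edge `Re v = σ`.
  set V : ℕ → ℝ := fun q => (q.divisors.card : ℝ) ^ (M + M' + 1) * (q : ℝ) ^ (-E₁) +
    (q.divisors.card : ℝ) ^ (M + M' + 1) * (q : ℝ) ^ (-E₂) with hV
  have hVs : Summable V := (summable_card_divisors_pow_mul_rpow _ hE₁).add
    (summable_card_divisors_pow_mul_rpow _ hE₂)
  have hTV : ∀ (q : ℕ) (v : ℂ), v ∈ {v : ℂ | σ < v.re} → ‖T q v‖ ≤ V q := by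
    intro q v hv
    have hv' : σ < v.re := hv
    rcases eq_or_ne q 0 with rfl | hq
    · simp only [hT, hJ0, zero_mul, norm_zero, hV]
      positivity
    have hq1 : (1 : ℝ) ≤ q := by exact_mod_cast Nat.one_le_iff_ne_zero.mpr hq
    have hq0 : (0 : ℝ) < q := by linarith
    have b1 := norm_jordanSum_le hq (v - a - b)
    have b2 := (hρ q hq).2.1 _ (hare v hv)
    have b3 := (hρ' q hq).2.1 _ (hbre v hv)
    set t : ℝ := (q.divisors.card : ℝ) with ht
    have ht0 : 0 ≤ t := Nat.cast_nonneg _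
    calc ‖T q v‖ ≤ (t * (1 + (q : ℝ) ^ (v - a - b).re)) *
          ((t ^ M * (q : ℝ) ^ (-(v - a).re - m)) * (t ^ M' * (q : ℝ) ^ (-(v - b).re - m'))) := by
          rw [hT, norm_mul, norm_mul]
          exact mul_le_mul b1 (mul_le_mul b2 b3 (norm_nonneg _) (by positivity)) (by positivity)
            (by positivity)
      _ = t ^ (M + M' + 1) * ((q : ℝ) ^ ((-(v - a).re - m) + (-(v - b).re - m'))) +
          t ^ (M + M' + 1) * ((q : ℝ) ^ ((v - a - b).re +
            ((-(v - a).re - m) + (-(v - b).re - m')))) := by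
          rw [Real.rpow_add hq0 (v - a - b).re, Real.rpow_add hq0 (-(v - a).re - m), pow_succ,
            pow_add]
          ring
      _ ≤ V q := by
          refine add_le_add (mul_le_mul_of_nonneg_left ?_ (by positivity))
            (mul_le_mul_of_nonneg_left ?_ (by positivity)) <;>
          · refine Real.rpow_le_rpow_of_exponent_le hq1 ?_
            simp only [sub_re]
            linarith
  have hopen : IsOpen {v : ℂ | σ < v.re} := isOpen_lt continuous_const continuous_re
  have hTd : ∀ q, DifferentiableOn ℂ (T q) {v : ℂ | σ < v.re} := by
    intro q v hv
    rcases eq_or_ne q 0 with rfl | hq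
    · have : T 0 = fun _ => 0 := by ext v; simp [hT, hJ0]
      rw [this]
      exact differentiableWithinAt_const _
    · have h1 : AnalyticAt ℂ (fun v => jordanSum q (v - a - b)) v :=
        AnalyticAt.fun_comp (f := fun v : ℂ => v - a - b) (jordanSum_analyticAt q _) (by fun_prop)
      have h2 : AnalyticAt ℂ (fun v => ρ q (v - a)) v :=
        AnalyticAt.fun_comp (f := fun v : ℂ => v - a) ((hρ q hq).1 _ (hare v hv)) (by fun_prop)
      have h3 : AnalyticAt ℂ (fun v => ρ' q (v - b)) v :=
        AnalyticAt.fun_comp (f := fun v : ℂ => v - b) ((hρ' q hq).1 _ (hbre v hv)) (by fun_prop)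
      exact (h1.fun_mul (h2.fun_mul h3)).differentiableAt.differentiableWithinAt
  have hEd := differentiableOn_tsum_of_summable_norm hVs hTd hopen hTV
  have hEa : ∀ v : ℂ, σ < v.re → AnalyticAt ℂ (fun v => ∑' q, T q v) v := fun v hv =>
    hEd.analyticAt (hopen.mem_nhds hv)
  have hfactor : ∀ v : ℂ, ∀ q, jordanSum q (v - a - b) *
      ((Zf (v - a) * ρ q (v - a)) * (Zg (v - b) * ρ' q (v - b))) =
        (Zf (v - a) * Zg (v - b)) * T q v := fun v q => by rw [hT]; ring
  have hval : ∀ q, jordanSum q (u - a - b) *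
      (continuedLSeries (fun n => if q ∣ n then f n else 0) (u - a) *
        continuedLSeries (fun n => if q ∣ n then g n else 0) (u - b)) =
        (Zf (u - a) * Zg (u - b)) * T q u := by
    intro q
    rcases eq_or_ne q 0 with rfl | hq
    · simp [hT, hJ0]
    rw [← hfactor, (hρ q hq).2.2.continuedLSeries_eq (hare u hu) huP,
      (hρ' q hq).2.2.continuedLSeries_eq (hbre u hu) huQ]
  have hTs : Summable fun q => T q u := Summable.of_norm_bounded hVs fun q => hTV q u hu
  simp only [hval]
  refine ⟨hTs.mul_left _, ?_⟩
  set K := max K₁ K₂ with hKdef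
  have hfK := hf1 K (le_max_left _ _)
  have hgK := hg1 K (le_max_right _ _)
  have hK : 0 ≤ K := hK₁.trans (le_max_left _ _)
  refine ⟨fun v => riemannZeta (v - a - b) * ∑' q, (Zf (v - a) * Zg (v - b)) * T q v, σ,
    max σ (2 * K + 7 + |a.re| + |b.re|), hu, fun v hv => ?_, fun v hv => ?_, ?_, rfl⟩
  · simp only [tsum_mul_left]
    have h1 : MeromorphicAt (fun v => riemannZeta (v - a - b)) v :=
      MeromorphicAt.comp_analyticAt (g := fun v : ℂ => v - a - b) (riemannZeta_meromorphicAt _)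
        (by fun_prop)
    have h2 : MeromorphicAt (fun v => Zf (v - a)) v :=
      MeromorphicAt.comp_analyticAt (g := fun v : ℂ => v - a) (hZf _ (hare v hv)) (by fun_prop)
    have h3 : MeromorphicAt (fun v => Zg (v - b)) v :=
      MeromorphicAt.comp_analyticAt (g := fun v : ℂ => v - b) (hZg _ (hbre v hv)) (by fun_prop)
    exact h1.fun_mul ((h2.fun_mul h3).fun_mul (hEa v hv).meromorphicAt)
  · have hv1 : σ < v.re := lt_of_le_of_lt (le_max_left _ _) hv
    have hv2 := lt_of_le_of_lt (le_max_right _ _) hv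
    obtain ⟨h1, h2⟩ := LSeries_rankin_eq hK hc₁ hc₂ hfK hgK hv2
    refine ⟨h1, ?_⟩
    rw [h2]
    refine congrArg (riemannZeta (v - a - b) * ·) (tsum_congr fun q => ?_)
    rcases eq_or_ne q 0 with rfl | hq
    · simp [hT, hJ0]
    have la := le_abs_self a.re
    have lb := le_abs_self b.re
    have la' := abs_nonneg a.re
    have lb' := abs_nonneg b.re
    have hre : (((K + 2 : ℝ) : ℂ)).re = K + 2 := ofReal_re _
    -- The abscissa beyond which a continuation is known to equal its series may depend on `q`,
    -- whereas one half-plane must serve all `q`. Uniqueness of continuation extends the equality to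
    -- everything right of `K + 2`, and the possible poles have real part at most `2`.
    rw [← hfactor, (hρ q hq).2.2.LSeries_eq (w₀ := ((K + 2 : ℝ) : ℂ))
        (LSeriesSummable_multiples hc₁ hfK q (by rw [hre]; linarith))
        (by rw [hre, sub_re]; linarith) (hare v hv1)
        (fun h => by have := hP _ h; rw [sub_re] at this; linarith),
      (hρ' q hq).2.2.LSeries_eq (w₀ := ((K + 2 : ℝ) : ℂ))
        (LSeriesSummable_multiples hc₂ hgK q (by rw [hre]; linarith))
        (by rw [hre, sub_re]; linarith) (hbre v hv1)
        (fun h => by have := hQ _ h; rw [sub_re] at this; linarith)]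
  · simp only [tsum_mul_left]
    have h1 : AnalyticAt ℂ (fun v => riemannZeta (v - a - b)) u :=
      AnalyticAt.fun_comp (f := fun v : ℂ => v - a - b) (riemannZeta_analyticAt hu1) (by fun_prop)
    have h2 : AnalyticAt ℂ (fun v => Zf (v - a)) u :=
      AnalyticAt.fun_comp (f := fun v : ℂ => v - a) (hZf' _ (hare u hu) huP) (by fun_prop)
    have h3 : AnalyticAt ℂ (fun v => Zg (v - b)) u :=
      AnalyticAt.fun_comp (f := fun v : ℂ => v - b) (hZg' _ (hbre u hu) huQ) (by fun_prop)
    exact h1.fun_mul ((h2.fun_mul h3).fun_mul (hEa u hu))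

/-! ### The swap terms and the final summation. -/

theorem I_union_singleton {A C : Finset ℂ} {x : ℂ} (hx : x ∉ A) :
    I (A ∪ {x}) C = powFun x * I A C := by
  rw [I, I, ← mul_assoc, Finset.union_comm, Finset.singleton_union, Finset.prod_insert hx]

/-- A finite set of strict inequalities leaves room for one bound `m`, still strictly above `-1/4`
and `-ε`; adjoining `0` covers the empty set. -/
theorem exists_re_lower_bound (S : Finset ℂ) {ε : ℝ} (hε : 0 < ε)
    (hS : ∀ x ∈ S, -(1 / 4) < x.re ∧ -ε < x.re) :
    ∃ m : ℝ, -(1 / 4) < m ∧ -ε < m ∧ ∀ x ∈ S, m ≤ x.re := by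
  classical
  have hne : (insert (0 : ℂ) S).Nonempty := Finset.insert_nonempty _ _
  obtain ⟨x₀, hx₀, hmin⟩ := (insert (0 : ℂ) S).exists_min_image re hne
  refine ⟨x₀.re, ?_, ?_, fun x hx => hmin x (Finset.mem_insert_of_mem hx)⟩ <;>
  · rcases Finset.mem_insert.mp hx₀ with rfl | h
    · simp only [zero_re]; linarith
    · linarith [(hS x₀ h).1, (hS x₀ h).2]

/-- One swap term: the sum over `q` of the products of residues. -/
theorem GRH.swap_term (hGRH : GRH) {A B C D : Finset ℂ}
    (hA : ∀ α ∈ A, |α.re| < 1 / 4) (hB : ∀ β ∈ B, |β.re| < 1 / 4)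
    (hC : ∀ γ ∈ C, 0 < γ.re) (hD : ∀ η ∈ D, 0 < η.re) {ε : ℝ} (hε0 : 0 < ε)
    (hshift : ∀ x ∈ A ∪ B ∪ C ∪ D, ‖x‖ < ε) {s : ℂ} (hs : 2 * ε < s.re) {α β : ℂ}
    (hα : α ∈ A) (hβ : β ∈ B) :
    Summable (fun q : ℕ => jordanSum q (1 - α - β - s) *
        (continuedLSeries (fun n => if q ∣ n then I (A.erase α) C n else 0) (1 - α) *
          continuedLSeries (fun n => if q ∣ n then I (B.erase β) D n else 0) (1 - β))) ∧
      HasContinuedValue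
        (rankinCoeff ((A \ {α}) ∪ negShift s {β}) ((B \ {β}) ∪ negShift s {α}) C D) (s + 1)
        (riemannZeta (1 - α - β - s) * ∑' q : ℕ, jordanSum q (1 - α - β - s) *
          (continuedLSeries (fun n => if q ∣ n then I (A.erase α) C n else 0) (1 - α) *
            continuedLSeries (fun n => if q ∣ n then I (B.erase β) D n else 0) (1 - β))) := by
  have hεA : ∀ x ∈ A, ‖x‖ < ε := fun x hx => hshift x (by simp [hx])
  have hεB : ∀ x ∈ B, ‖x‖ < ε := fun x hx => hshift x (by simp [hx])
  have hreA : ∀ x ∈ A, -ε < x.re ∧ x.re < ε := fun x hx =>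
    abs_lt.mp (lt_of_le_of_lt (abs_re_le_norm x) (hεA x hx))
  have hreB : ∀ x ∈ B, -ε < x.re ∧ x.re < ε := fun x hx =>
    abs_lt.mp (lt_of_le_of_lt (abs_re_le_norm x) (hεB x hx))
  obtain ⟨m, hm1, hm2, hm⟩ := exists_re_lower_bound (A ∪ B ∪ C ∪ D) hε0 fun x hx => by
    simp only [Finset.mem_union] at hx
    rcases hx with ((hx | hx) | hx) | hx
    · exact ⟨(abs_lt.mp (hA x hx)).1, (hreA x hx).1⟩
    · exact ⟨(abs_lt.mp (hB x hx)).1, (hreB x hx).1⟩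
    · constructor <;> linarith [hC x hx]
    · constructor <;> linarith [hD x hx]
  have hIA := hGRH.hasDvdFactor_I (A.erase α) C (m := m)
    (fun x hx => ⟨by linarith [(abs_lt.mp (hA x (Finset.mem_of_mem_erase hx))).1],
      hm x (by simp [Finset.mem_of_mem_erase hx])⟩)
    fun x hx => ⟨hC x hx, hm x (by simp [hx])⟩
  have hIB := hGRH.hasDvdFactor_I (B.erase β) D (m := m)
    (fun x hx => ⟨by linarith [(abs_lt.mp (hB x (Finset.mem_of_mem_erase hx))).1],
      hm x (by simp [Finset.mem_of_mem_erase hx])⟩)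
    fun x hx => ⟨hD x hx, hm x (by simp [hx])⟩
  have hα1 := abs_lt.mp (hA α hα)
  have hβ1 := abs_lt.mp (hB β hβ)
  have hpole : ∀ {A' : Finset ℂ} {x₀ : ℂ}, (∀ x ∈ A', |x.re| < 1 / 4) →
      ∀ w ∈ {w : ℂ | 1 - w ∈ A'.erase x₀}, w.re ≤ 2 := by
    intro A' x₀ hA' w hw
    have := (abs_lt.mp (hA' _ (Finset.mem_of_mem_erase hw))).1
    rw [sub_re, one_re] at this
    linarith
  -- The half-plane must reach strictly to the left of `s + 1`. At `σ = Re s + 1` the two exponents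
  -- are `2 - Re α - Re β + 2m` and `Re s + 1 + 2m`; both exceed `1`, by the bounds `1/4` and by `Re
  -- s > 2ε` with `m > -ε`. The step `η` uses up only half of each surplus.
  set η : ℝ := min (1 / 4) (min ((1 - α.re - β.re + 2 * m) / 4) ((s.re + 2 * m) / 2)) with hη
  have hη1 : η ≤ 1 / 4 := min_le_left _ _
  have hη2 : η ≤ (1 - α.re - β.re + 2 * m) / 4 := (min_le_right _ _).trans (min_le_left _ _)
  have hη3 : η ≤ (s.re + 2 * m) / 2 := (min_le_right _ _).trans (min_le_right _ _)
  have hη0 : 0 < η := lt_min (by norm_num) (lt_min (by linarith [hα1.2, hβ1.2]) (by linarith))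
  -- With `a = α + s` and `b = β + s`, the point `u = s + 1` is carried to the residue points `1 -
  -- α`, `1 - β` and to the kernel argument `1 - α - β - s`.
  have e1 : s + 1 - (α + s) = 1 - α := by ring
  have e2 : s + 1 - (β + s) = 1 - β := by ring
  have e3 : 1 - α - (β + s) = 1 - α - β - s := by ring
  have key := hasContinuedValue_rankin hIA hIB
    (fun w hw => hGRH.zetaQuotient_meromorphicAt hC hw)
    (fun w hw hw' => hGRH.zetaQuotient_analyticAt hC hw hw')
    (fun w hw => hGRH.zetaQuotient_meromorphicAt hD hw)
    (fun w hw hw' => hGRH.zetaQuotient_analyticAt hD hw hw')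
    (hpole hA) (hpole hB) (a := α + s) (b := β + s) (σ := s.re + 1 - η) (u := s + 1)
    (by rw [add_re]; linarith [hα1.2]) (by rw [add_re]; linarith [hβ1.2])
    (by simp only [add_re]; linarith) (by linarith)
    (by rw [add_re, one_re]; linarith) (by simp [e1]) (by simp [e2])
    (by
      rw [e1, e3]
      intro h
      have := congrArg re h
      simp only [sub_re, one_re] at this
      linarith [(hreA α hα).1, (hreB β hβ).1])
  rw [e1, e2, e3] at key
  -- The swapped shift has real part below `ε - 2ε = -ε`, hence is a genuinely new element.
  -- Otherwise the union of sets would lose a zeta factor.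
  have hnotA : -(β + s) ∉ A.erase α := fun h => by
    have := (hreA _ (Finset.mem_of_mem_erase h)).1
    rw [neg_re, add_re] at this
    linarith [(hreB β hβ).1]
  have hnotB : -(α + s) ∉ B.erase β := fun h => by
    have := (hreB _ (Finset.mem_of_mem_erase h)).1
    rw [neg_re, add_re] at this
    linarith [(hreA α hα).1]
  have hcoef : rankinCoeff ((A \ {α}) ∪ negShift s {β}) ((B \ {β}) ∪ negShift s {α}) C D =
      fun n => (powFun (-(β + s)) * I (A.erase α) C) n * (powFun (-(α + s)) * I (B.erase β) D) n := by
    ext n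
    rw [rankinCoeff, negShift, negShift, Finset.image_singleton, Finset.image_singleton,
      Finset.sdiff_singleton_eq_erase, Finset.sdiff_singleton_eq_erase,
      I_union_singleton hnotA, I_union_singleton hnotB]
  rw [hcoef]
  exact key

theorem tsum_pnat_eq_tsum_nat {f : ℕ → ℂ} (hf : f 0 = 0) : ∑' q : ℕ+, f q = ∑' q, f q :=
  PNat.coe_injective.tsum_eq (f := f) fun n hn =>
    ⟨⟨n, Nat.pos_of_ne_zero fun h => hn (by rw [h, hf])⟩, rfl⟩

end OneSwap

theorem theorem1 (hGRH : OneSwap.GRH) (A B C D : Finset ℂ)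
    (hA : ∀ α ∈ A, |α.re| < 1 / 4) (hB : ∀ β ∈ B, |β.re| < 1 / 4)
    (hC : ∀ γ ∈ C, 0 < γ.re ∧ γ.re < 1 / 4) (hD : ∀ δ ∈ D, 0 < δ.re ∧ δ.re < 1 / 4)
    (ε : ℝ) (hε0 : 0 < ε) (hε : ε < 1 / 2)
    (hshift : ∀ x ∈ A ∪ B ∪ C ∪ D, ‖x‖ < ε)
    (s : ℂ) (hs : 2 * ε < s.re) :
    -- all continuations that enter exist and are analytic where they are evaluated
    (∀ q : ℕ+, ∀ w ∈ Metric.sphere (1 : ℂ) ε,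
      OneSwap.ContinuesTo (OneSwap.twist A C q) w ∧
      OneSwap.ContinuesTo (OneSwap.twist B D q) w) ∧
    (∀ q : ℕ+, ∀ w ∈ Metric.sphere (1 : ℂ) ε, ∀ z ∈ Metric.sphere (1 : ℂ) ε,
      s + 2 - w - z ≠ 1 → OneSwap.ContinuesTo (OneSwap.ramanujanSum q) (s + 2 - w - z)) ∧
    (∀ U ∈ A.powersetCard 1, ∀ V ∈ B.powersetCard 1,
      OneSwap.ContinuesTo
        (OneSwap.rankinCoeff ((A \ U) ∪ OneSwap.negShift s V) ((B \ V) ∪ OneSwap.negShift s U) C D)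
        (s + 1)) ∧
    -- the identity
    Summable (fun q : ℕ+ => OneSwap.correlationTerm A B C D ε s q) ∧
    OneSwap.correlation A B C D ε s =
      ∑ U ∈ A.powersetCard 1, ∑ V ∈ B.powersetCard 1,
        OneSwap.rankin ((A \ U) ∪ OneSwap.negShift s V) ((B \ V) ∪ OneSwap.negShift s U) C D
          (s + 1) := by
  have hC' : ∀ γ ∈ C, 0 < γ.re := fun γ hγ => (hC γ hγ).1
  have hD' : ∀ δ ∈ D, 0 < δ.re := fun δ hδ => (hD δ hδ).1
  have hεA : ∀ x ∈ A, ‖x‖ < ε := fun x hx => hshift x (by simp [hx])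
  have hεB : ∀ x ∈ B, ‖x‖ < ε := fun x hx => hshift x (by simp [hx])
  have hswap := fun α hα β hβ =>
    hGRH.swap_term hA hB hC' hD' hε0 hshift hs (α := α) (β := β) hα hβ
  have hsph : ∀ w ∈ Metric.sphere (1 : ℂ) ε, 1 / 2 < w.re ∧
      ∀ A' : Finset ℂ, (∀ x ∈ A', ‖x‖ < ε) → 1 - w ∉ A' := by
    intro w hw
    rw [mem_sphere_iff_norm] at hw
    have h := Complex.abs_re_le_norm (w - 1)
    rw [hw, Complex.sub_re, Complex.one_re, abs_le] at h
    -- The poles `1 - x` lie strictly inside the circle because `‖x‖ < ε`, and `ε < 1/2` keeps the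
    -- circle in `Re w > 1/2`.
    refine ⟨by linarith [h.1], fun A' hA' h' => ?_⟩
    have := hA' _ h'
    rw [norm_sub_rev, hw] at this
    exact lt_irrefl _ this
  have hterm : ∀ q : ℕ+, OneSwap.correlationTerm A B C D ε s q = ∑ α ∈ A, ∑ β ∈ B,
      riemannZeta (1 - α - β - s) * (OneSwap.jordanSum q (1 - α - β - s) *
        (OneSwap.continuedLSeries
            (fun n => if (q : ℕ) ∣ n then OneSwap.I (A.erase α) C n else 0) (1 - α) *
          OneSwap.continuedLSeries
            (fun n => if (q : ℕ) ∣ n then OneSwap.I (B.erase β) D n else 0) (1 - β))) := by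
    intro q
    rw [hGRH.correlationTerm_eq hC' hD' hε0 hε hεA hεB hs q.ne_zero]
    exact Finset.sum_congr rfl fun α _ => Finset.sum_congr rfl fun β _ => by ring
  have hsum := fun α hα β hβ => (((hswap α hα β hβ).1.mul_left
    (riemannZeta (1 - α - β - s))).comp_injective PNat.coe_injective)
  simp only [Function.comp_def] at hsum
  refine ⟨fun q w hw => ?_, fun q w _ z _ h => ?_, fun U hU V hV => ?_, ?_, ?_⟩
  · have : NeZero (q : ℕ) := ⟨q.ne_zero⟩
    obtain ⟨h1, h2⟩ := hsph w hw
    exact ⟨(hGRH.continuedLSeries_twist hC' q h1 (h2 A hεA)).1,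
      (hGRH.continuedLSeries_twist hD' q h1 (h2 B hεB)).1⟩
  · exact ⟨_, OneSwap.hasContinuedValue_ramanujanSum q.ne_zero h⟩
  · obtain ⟨α, rfl⟩ := Finset.card_eq_one.mp (Finset.mem_powersetCard.mp hU).2
    obtain ⟨β, rfl⟩ := Finset.card_eq_one.mp (Finset.mem_powersetCard.mp hV).2
    exact ⟨_, (hswap α (by simpa using (Finset.mem_powersetCard.mp hU).1)
      β (by simpa using (Finset.mem_powersetCard.mp hV).1)).2⟩
  · simp only [hterm]
    exact summable_sum fun α hα => summable_sum fun β hβ => hsum α hα β hβ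
  · rw [OneSwap.correlation, tsum_congr hterm,
      Summable.tsum_finsetSum fun α hα => summable_sum fun β hβ => hsum α hα β hβ]
    simp only [Finset.powersetCard_one, Finset.sum_map, Function.Embedding.coeFn_mk]
    refine Finset.sum_congr rfl fun α hα => ?_
    rw [Summable.tsum_finsetSum fun β hβ => hsum α hα β hβ]
    refine Finset.sum_congr rfl fun β hβ => ?_
    rw [OneSwap.rankin, (hswap α hα β hβ).2.continuedLSeries_eq, tsum_mul_left,
      OneSwap.tsum_pnat_eq_tsum_nat (f := fun q => OneSwap.jordanSum q (1 - α - β - s) *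
        (OneSwap.continuedLSeries
            (fun n => if q ∣ n then OneSwap.I (A.erase α) C n else 0) (1 - α) *
          OneSwap.continuedLSeries
            (fun n => if q ∣ n then OneSwap.I (B.erase β) D n else 0) (1 - β)))
        (by simp [OneSwap.jordanSum])]
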